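/- Let $F$ be a field of characteristic $\neq 2$ with separable closure $F^{\rm sep}$, let $f=(x-\gamma)^2-\delta\in F[x]$, write $f^{(n)}$ for the $n$-th iterate ($f^{(0)}=x$), and assume that $f^{(n)}$ is separable for every $n\ge 0$. Let $T_\infty$ be the rooted binary tree whose vertices are the words in two letters $x,y$, a word $w$ having the two children $xw$ and $yw$, and let $\Omega_\infty=\mathrm{Aut}(T_\infty)$. For $i\ge 0$ let $\varphi_i:\Omega_\infty\to\mathbb F_2$ be the homomorphism sending $\sigma$ to the parity of the number of words $w$ of length $i$ with $\sigma(xw)=y\,\sigma(w)$; for a finitely supported vector $a=(a_i)_{i\ge 0}$ over $\mathbb F_2$ put $M_a=\ker\big(\sum_i a_i\varphi_i\big)$. The tree $T_\infty(f)$ has as vertices of level $n$ the roots of $f^{(n)}$ in $F^{\rm sep}$, a vertex $\beta$ being the parent of $\alpha$ (one level further) when $f(\alpha)=\beta$; it is isomorphic to $T_\infty$. Fix any isomorphism $\iota:T_\infty(f)\to T_\infty$ and let $\mathrm{im}(\rho_f)\subseteq\Omega_\infty$ be the image, transported by $\iota$, of the action $\rho_f$ of $\mathrm{Gal}(F^{\rm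 sep}/F)$ on $T_\infty(f)$. Put $c_0=-f(\gamma)=\delta$, $c_n=f^{(n+1)}(\gamma)$ for $n\ge 1$, and $c_a=\prod_i c_i^{a_i}$. For a letter $s\in\{x,y\}$ let $\alpha_s=\iota^{-1}(s)$ be the corresponding root of $f$, and put $\widetilde c_1(s)=c_0+\alpha_s$, $\widetilde c_i(s)=c_{i-1}-\alpha_s$ for $i\ge 2$, and $\widetilde c_a(s)=\prod_{i\ge 1}\widetilde c_i(s)^{a_i}$. Let $a\ne 0$ be a finitely supported vector and $e_0=(1,0,0,\dots)$. If $a_0=0$ and $c_a\in {F^\times}^2$, put $\widetilde c_a=2d+\widetilde c_a(x)+\widetilde c_a(y)$, where $d\in F$ satisfies $d^2=\widetilde c_a(x)\,\widetilde c_a(y)\;(=c_a)$ and is chosen such that $\widetilde c_a\ne 0$; such a $d$ exists, and $\widetilde c_a\in F^\times$ does not depend on its choice modulo the span of $\{c_n\}_{n\ge 0}$ in the $\mathbb F_2$-vector space $F^\times/{F^\times}^2$. 1. Suppose $a\neq e_0$. Then $\mathrm{im}(\rho_f)=M_a$ if and only if one of the following holds: a) $a_0=1$, $c_a\in {F^\times}^2$,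 and $c_b\notin {F^\times}^2$ for every finitely supported $b\neq 0,a$; b) $a_0=0$, $c_a\in {F^\times}^2$, $c_b\notin {F^\times}^2$ for every finitely supported $b\neq 0,a$, and $\widetilde c_a$ does not belong to the span of $\{c_n\}_{n\ge 0}$ in $F^\times/{F^\times}^2$. In this case $f$ is stable, that is, $f\circ f^{(n)}$ is irreducible for every $n\ge 1$. 2. Suppose $a=e_0$. Then $\mathrm{im}(\rho_f)=M_{e_0}$ if and only if there is $u\in F$ with $u^2=\delta$ such that the family $c_0+\gamma\pm u,\ c_1-\gamma\pm u,\ c_2-\gamma\pm u,\dots$ consists of nonzero elements that are linearly independent in $F^\times/{F^\times}^2$. In this case $f=gh$ with $g,h\in F[x]$ of degree one that are $f$-stable, that is, $g\circ f^{(n)}$ and $h\circ f^{(n)}$ are irreducible for every $n\ge 1$. -/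

import Mathlib

open Polynomial

namespace Arboreal

universe u v

/-! ## The infinite rooted regular binary tree and its automorphism group -/

/-- Words in the free monoid on two letters `x = false` and `y = true`; the head of the list is the
leftmost letter, so that `s :: w` is the word `s w`. -/
abbrev Word : Type := List Bool

/-- The edges of the tree (the Cayley graph of the free monoid), oriented away from the root: each
word `w` is joined to `x w` and to `y w`. -/
def TreeEdge (w v : Word) : Prop := ∃ s : Bool, v = s :: w

/-- The automorphism group of the infinite rooted regular binary tree. -/
abbrev Omega : Type := TreeEdge ≃r TreeEdge

theorem Omega.map_nil (σ : Omega) : σ [] = [] := by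
  cases h : σ [] with
  | nil => rfl
  | cons s w =>
    exfalso
    have h1 : TreeEdge (σ (σ.symm w)) (σ []) := by
      rw [h, RelIso.apply_symm_apply]; exact ⟨s, rfl⟩
    obtain ⟨t, ht⟩ := σ.map_rel_iff.1 h1
    cases ht

theorem Omega.map_cons (σ : Omega) (s : Bool) (w : Word) : ∃ t : Bool, σ (s :: w) = t :: σ w :=
  σ.map_rel_iff.2 (⟨s, rfl⟩ : TreeEdge w (s :: w))

theorem Omega.length_map (σ : Omega) (w : Word) : (σ w).length = w.length := by
  induction w with
  | nil => rw [σ.map_nil]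
  | cons s w ih =>
    obtain ⟨t, ht⟩ := σ.map_cons s w
    rw [ht, List.length_cons, List.length_cons, ih]

theorem Omega.map_cons_eq (σ : Omega) (s : Bool) (w : Word) :
    σ (s :: w) = (xor s (decide (σ (false :: w) ≠ false :: σ w))) :: σ w := by
  obtain ⟨t, ht⟩ := σ.map_cons false w
  obtain ⟨t', ht'⟩ := σ.map_cons true w
  have hne : t ≠ t' := by
    rintro rfl
    have := σ.injective (ht.trans ht'.symm)
    simp at this
  cases s <;> cases t <;> cases t' <;> simp_all

/-- `swap σ w` is `1` if `σ`, in mapping the two children `x w`, `y w` of `w` to the two children of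
`σ w`, exchanges the letters `x` and `y`, and `0` otherwise. -/
def swap (σ : Omega) (w : Word) : ZMod 2 := if σ (false :: w) = false :: σ w then 0 else 1

theorem swap_mul (σ τ : Omega) (w : Word) : swap (σ * τ) w = swap σ (τ w) + swap τ w := by
  have h2 : (1 : ZMod 2) + 1 = 0 := by decide
  unfold swap
  have h1 : ∀ v, (σ * τ) v = σ (τ v) := fun v => rfl
  rw [h1, h1, τ.map_cons_eq false w, σ.map_cons_eq _ (τ w)]
  by_cases a : τ (false :: w) = false :: τ w <;>
    by_cases b : σ (false :: τ w) = false :: σ (τ w) <;> simp [a, b, h2]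

/-- The character `φ i` of `Omega`: the sum, over the `2 ^ i` words `w` of length `i`, of the digits
`swap σ w`. It is a homomorphism (`phi_mul`) and sends the involution attached to a word `w` to `1`
if `w` has length `i` and to `0` otherwise (`phi_rotation`). -/
def phi (i : ℕ) (σ : Omega) : ZMod 2 := ∑ w : List.Vector Bool i, swap σ w.toList

/-- The permutation of the words of length `i` induced by an automorphism of the tree. -/
def levelPerm (σ : Omega) (i : ℕ) : Equiv.Perm (List.Vector Bool i) where
  toFun w := ⟨σ w.toList, by rw [σ.length_map]; exact w.2⟩
  invFun w := ⟨σ.symm w.toList, by rw [Omega.length_map σ.symm]; exact w.2⟩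
  left_inv w := Subtype.ext (σ.symm_apply_apply w.1)
  right_inv w := Subtype.ext (σ.apply_symm_apply w.1)

theorem phi_mul (i : ℕ) (σ τ : Omega) : phi i (σ * τ) = phi i σ + phi i τ := by
  unfold phi
  simp only [swap_mul]
  rw [Finset.sum_add_distrib]
  congr 1
  exact Equiv.sum_comp (levelPerm τ i) (fun w => swap σ w.toList)

theorem phi_one (i : ℕ) : phi i 1 = 0 := by
  have h := phi_mul i 1 1
  rw [mul_one] at h
  simpa using h

/-- The action on words of the involution attached to the word `w`: exchange `x` and `y` in `v'` in
the words `v' w`, and fix the words that do not end in `w`. -/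
def rotate (w : Word) : Word → Word
  | [] => []
  | s :: v => (if w <:+ v then !s else s) :: rotate w v

theorem rotate_rotate (w v : Word) : rotate w (rotate w v) = v := by
  have key : ∀ v : Word, (w <:+ rotate w v ↔ w <:+ v) := by
    have hlen : ∀ v : Word, (rotate w v).length = v.length := by
      intro v
      induction v with
      | nil => rfl
      | cons s v ih => simp [rotate, ih]
    have hfix : ∀ v : Word, v.length ≤ w.length → rotate w v = v := by
      intro v
      induction v with
      | nil => intro _; rfl
      | cons s v ih =>
        intro h
        rw [List.length_cons] at h
        have : ¬ w <:+ v := fun hs => by have := hs.length_le; omega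
        simp [rotate, this, ih (by omega)]
    intro v
    induction v with
    | nil => rfl
    | cons s v ih =>
      rcases Nat.lt_or_ge w.length (v.length + 1) with h | h
      · have aux : ∀ (t : Bool) (u : Word), u.length = v.length → (w <:+ t :: u ↔ w <:+ u) := by
          intro t u hu
          rw [List.suffix_cons_iff]
          constructor
          · rintro (h' | h')
            · rw [h', List.length_cons, hu] at h; omega
            · exact h'
          · exact Or.inr
        rw [rotate, aux _ _ (hlen v), aux _ _ rfl, ih]
      · rw [hfix (s :: v) (by simpa using h)]
  induction v with
  | nil => rfl
  | cons s v ih =>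
    simp only [rotate, key, ih]
    by_cases h : w <:+ v <;> simp [h]

/-- The involution of the tree attached to the word `w`. -/
def rotation (w : Word) : Omega where
  toFun := rotate w
  invFun := rotate w
  left_inv := rotate_rotate w
  right_inv := rotate_rotate w
  map_rel_iff' := by
    have h : ∀ a b : Word, TreeEdge a b → TreeEdge (rotate w a) (rotate w b) := by
      rintro a _ ⟨s, rfl⟩
      exact ⟨_, rfl⟩
    intro a b
    refine ⟨fun hab => ?_, h a b⟩
    have := h _ _ hab
    simpa [rotate_rotate] using this

theorem rotation_append (v w : Word) : rotation w (v ++ w) = v.map (fun s => !s) ++ w := by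
  have hself : ∀ u : Word, u.length ≤ w.length → rotate w u = u := by
    intro u
    induction u with
    | nil => intro _; rfl
    | cons s u ih =>
      intro h
      rw [List.length_cons] at h
      have : ¬ w <:+ u := fun hs => by have := hs.length_le; omega
      simp [rotate, this, ih (by omega)]
  change rotate w (v ++ w) = _
  induction v with
  | nil => exact hself w le_rfl
  | cons s v ih =>
    have : w <:+ v ++ w := List.suffix_append v w
    simp [rotate, this, ih]

theorem phi_rotation (i : ℕ) (w : Word) : phi i (rotation w) = if w.length = i then 1 else 0 := by
  have hswap : ∀ v : Word, swap (rotation w) v = if w <:+ v then 1 else 0 := by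
    intro v
    have : rotation w (false :: v) = (if w <:+ v then true else false) :: rotation w v := rfl
    unfold swap
    rw [this]
    by_cases h : w <:+ v <;> simp [h]
  unfold phi
  simp only [hswap]
  rcases lt_trichotomy w.length i with h | h | h
  · rw [if_neg h.ne]
    obtain ⟨j, rfl⟩ : ∃ j, i = j + 1 := ⟨i - 1, by omega⟩
    refine Finset.sum_involution (fun v _ => (!v.head) ::ᵥ v.tail) ?_ ?_ ?_ ?_
    · intro v _
      obtain ⟨s, u, rfl⟩ := v.exists_eq_cons
      have aux : ∀ t : Bool, (w <:+ (t ::ᵥ u).toList ↔ w <:+ u.toList) := by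
        intro t
        rw [List.Vector.toList_cons, List.suffix_cons_iff]
        constructor
        · rintro (h' | h')
          · rw [h', List.length_cons, List.Vector.toList_length] at h; omega
          · exact h'
        · exact Or.inr
      simp only [List.Vector.head_cons, List.Vector.tail_cons, aux]
      by_cases hw : w <:+ u.toList
      · simp only [hw, if_true]; decide
      · simp [hw]
    · intro v _ _ hv
      obtain ⟨s, u, rfl⟩ := v.exists_eq_cons
      have := congrArg List.Vector.head hv
      simp at this
    · intro v _; exact Finset.mem_univ _
    · intro v _
      obtain ⟨s, u, rfl⟩ := v.exists_eq_cons
      simp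
  · subst h
    rw [if_pos rfl]
    let w' : List.Vector Bool w.length := ⟨w, rfl⟩
    refine (Finset.sum_eq_single w' ?_ ?_).trans ?_
    · intro v _ hv
      refine if_neg fun hs => hv ?_
      exact Subtype.ext (hs.eq_of_length v.2.symm).symm
    · intro h; exact absurd (Finset.mem_univ _) h
    · exact if_pos (List.suffix_refl w)
  · rw [if_neg h.ne']
    refine Finset.sum_eq_zero fun v _ => if_neg fun hs => ?_
    have := hs.length_le
    rw [List.Vector.toList_length] at this
    omega

/-- The subgroup `M_a` of `Omega`, the kernel of the character `∑ a_i φ_i`, for a finitely supported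
vector `a` over the field with two elements. -/
def M (a : ℕ →₀ ZMod 2) : Subgroup Omega where
  carrier := {σ | (a.sum fun i e => e * phi i σ) = 0}
  one_mem' := by simp [phi_one]
  mul_mem' {σ τ} hσ hτ := by
    simp only [Set.mem_ofPred_eq] at hσ hτ ⊢
    simp only [phi_mul, mul_add, Finsupp.sum_add, hσ, hτ, add_zero]
  inv_mem' {σ} hσ := by
    have h : ∀ i, phi i σ⁻¹ = - phi i σ := fun i => by
      rw [eq_neg_iff_add_eq_zero, ← phi_mul, inv_mul_cancel, phi_one]
    simp only [Set.mem_ofPred_eq] at hσ ⊢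
    simp only [h, mul_neg, Finsupp.sum_neg, hσ, neg_zero]

/-! ## The tree of preimages of `0` and the arboreal representation -/

section Field

variable {F : Type u} [Field F]

/-- The polynomial `f = (x - γ) ^ 2 - δ`. -/
noncomputable def quad (γ δ : F) : F[X] := (X - C γ) ^ 2 - C δ

/-- The `n`-th iterate of a polynomial `f` under composition, the `0`-th iterate being `x`. -/
noncomputable def iter (f : F[X]) (n : ℕ) : F[X] := (fun g : F[X] => f.comp g)^[n] X

/-- `g` is `f`-stable if `g ∘ f^(n)` is irreducible for every `n ≥ 1`. -/
def IsStableFor (f g : F[X]) : Prop := ∀ n : ℕ, 1 ≤ n → Irreducible (g.comp (iter f n))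

/-- The nodes of the tree of `f`: the nodes of level `n` are the roots in `K` of the `n`-th iterate
of `f`. -/
def Node (f : F[X]) (K : Type v) [Field K] [Algebra F K] : Type v :=
  Σ n : ℕ, {α : K // aeval α (iter f n) = 0}

variable {f : F[X]} {K : Type v} [Field K] [Algebra F K]

/-- The level of a node. -/
def Node.level (p : Node f K) : ℕ := p.1

/-- The root of an iterate of `f` that a node stands for. -/
def Node.val (p : Node f K) : K := p.2.1

variable (f K) in
/-- The edges of the tree of `f`, oriented away from the root: a node `β` of level `n` is joined to
the nodes `α` of level `n + 1` with `f(α) = β`. -/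
def NodeEdge (p q : Node f K) : Prop := q.level = p.level + 1 ∧ aeval q.val f = p.val

/-- The action of a Galois automorphism on the nodes. -/
def galNode (σ : K ≃ₐ[F] K) (p : Node f K) : Node f K :=
  ⟨p.1, σ p.2.1, by
    have h := aeval_algHom_apply (σ : K →ₐ[F] K) p.2.1 (iter f p.1)
    rw [p.2.2, map_zero] at h
    exact h⟩

theorem NodeEdge.galNode {p q : Node f K} (σ : K ≃ₐ[F] K) (h : NodeEdge f K p q) :
    NodeEdge f K (galNode σ p) (galNode σ q) := by
  refine ⟨h.1, ?_⟩
  have h1 := aeval_algHom_apply (σ : K →ₐ[F] K) q.2.1 f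
  exact h1.trans (congrArg σ h.2)

variable (f K) in
/-- The arboreal representation: the action of the Galois group on the tree of `f`. -/
def arborealRep : (K ≃ₐ[F] K) →* (NodeEdge f K ≃r NodeEdge f K) where
  toFun σ :=
    { toFun := galNode σ
      invFun := galNode σ⁻¹
      left_inv := fun p => Sigma.ext rfl (heq_of_eq (Subtype.ext (σ.symm_apply_apply p.2.1)))
      right_inv := fun p => Sigma.ext rfl (heq_of_eq (Subtype.ext (σ.apply_symm_apply p.2.1)))
      map_rel_iff' := by
        intro p q
        refine ⟨fun h => ?_, NodeEdge.galNode σ⟩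
        have hp : ∀ p : Node f K, Arboreal.galNode σ⁻¹ (Arboreal.galNode σ p) = p := fun p =>
          Sigma.ext rfl (heq_of_eq (Subtype.ext (σ.symm_apply_apply p.2.1)))
        have h1 := NodeEdge.galNode σ⁻¹ h
        rw [← hp p, ← hp q]
        exact h1 }
  map_one' := RelIso.ext fun _ => rfl
  map_mul' _ _ := RelIso.ext fun _ => rfl

variable (f K) in
/-- The isomorphisms from the tree of `f` to the standard binary tree. -/
abbrev Labeling : Type v := NodeEdge f K ≃r TreeEdge

/-- The isomorphism of automorphism groups induced by an isomorphism of the trees. -/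
def Labeling.conj (ι : Labeling f K) : (NodeEdge f K ≃r NodeEdge f K) ≃* Omega where
  toFun g := (ι.symm.trans g).trans ι
  invFun g := (ι.trans g).trans ι.symm
  left_inv g := by ext p : 1; simp
  right_inv g := by ext p : 1; simp
  map_mul' g h := by ext p : 1; simp

/-- The image of the arboreal representation in `Omega`, read through a labeling of the tree. -/
def imRho (ι : Labeling f K) : Subgroup Omega :=
  (ι.conj.toMonoidHom.comp (arborealRep f K)).range

/-! ## The adjusted post-critical orbit and square classes -/

/-- The group of square classes of `F`, written additively. -/
abbrev SqClass (F : Type u) [Field F] : Type u :=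
  Additive (Fˣ ⧸ (powMonoidHom 2 : Fˣ →* Fˣ).range)

theorem two_nsmul_sqClass (x : SqClass F) : 2 • x = 0 := by
  have key : ∀ y : Fˣ ⧸ (powMonoidHom 2 : Fˣ →* Fˣ).range, y ^ 2 = 1 := by
    intro y
    induction y using QuotientGroup.induction_on with
    | H z => exact (QuotientGroup.eq_one_iff (z ^ 2)).2 ⟨z, rfl⟩
  apply Additive.toMul.injective
  rw [toMul_nsmul, toMul_zero]
  exact key x.toMul

/-- The square classes form a vector space over the field with two elements. -/
instance instModuleSqClass : Module (ZMod 2) (SqClass F) :=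
  AddCommGroup.zmodModule (n := 2) (G := SqClass F) two_nsmul_sqClass

/-- The class of a nonzero element of `F` modulo squares. -/
def sqClass (z : Fˣ) : SqClass F := Additive.ofMul (z : Fˣ ⧸ (powMonoidHom 2 : Fˣ →* Fˣ).range)

/-- `z` is the square of a nonzero element of `F`. -/
def IsUnitSq (z : F) : Prop := ∃ w : Fˣ, z = (w : F) ^ 2

/-- The elements of the family `x` are nonzero, and their classes modulo squares are linearly
independent over the field with two elements. -/
def IndepModSq {I : Type} (x : I → F) : Prop :=
  ∃ z : I → Fˣ, (∀ i, (z i : F) = x i) ∧ LinearIndependent (ZMod 2) fun i => sqClass (z i)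

/-- The adjusted post-critical orbit: `c_0 = -f(γ)` and `c_n = f^(n+1)(γ)` for `n ≥ 1`. -/
noncomputable def orbit (γ δ : F) : ℕ → F
  | 0 => -(quad γ δ).eval γ
  | n + 1 => (iter (quad γ δ) (n + 2)).eval γ

/-- The product `c_a` of the `c_i ^ a_i`. -/
noncomputable def orbitProd (γ δ : F) (a : ℕ →₀ ZMod 2) : F :=
  a.prod fun i e => orbit γ δ i ^ e.val

/-- The span of the classes of the `c_n` modulo squares. -/
def orbitSpan (γ δ : F) : Submodule (ZMod 2) (SqClass F) :=
  Submodule.span (ZMod 2) {y | ∃ (n : ℕ) (z : Fˣ), (z : F) = orbit γ δ n ∧ y = sqClass z}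

/-- `c_a` is the only product of the `c_i`, over a nonzero exponent vector, that is a square. -/
def OnlySquare (γ δ : F) (a : ℕ →₀ ZMod 2) : Prop :=
  IsUnitSq (orbitProd γ δ a) ∧
    ∀ b : ℕ →₀ ZMod 2, b ≠ 0 → b ≠ a → ¬ IsUnitSq (orbitProd γ δ b)

variable {γ δ : F}

/-- For a letter `s`, let `α_s` be the root of `f` labeled `s`. The elements attached to `s` are
`c_0 + α_s` for `i = 1` and `c_(i-1) - α_s` for `i ≥ 2`; up to the sign for `i = 1` this is
`f^(i)(γ) - α_s`, and the product over both `s` is `c_i`. The value `1` at `i = 0` is never used. -/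
noncomputable def cTilde (ι : Labeling (quad γ δ) K) (s : Bool) : ℕ → K
  | 0 => 1
  | 1 => algebraMap F K (orbit γ δ 0) + (ι.symm [s]).val
  | n + 2 => algebraMap F K (orbit γ δ (n + 1)) - (ι.symm [s]).val

/-- The product of the elements attached to the letter `s`, with exponents `a_i`. -/
noncomputable def cTildeProd (ι : Labeling (quad γ δ) K) (a : ℕ →₀ ZMod 2) (s : Bool) : K :=
  a.prod fun i e => cTilde ι s i ^ e.val

/-- `z` is a value of the auxiliary element: a nonzero element of `F` of the form
`2 d + c̃_a(x) + c̃_a(y)` with `d` in `F` a square root of `c̃_a(x) * c̃_a(y)`. -/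
def IsAuxElement (ι : Labeling (quad γ δ) K) (a : ℕ →₀ ZMod 2) (z : Fˣ) : Prop :=
  ∃ d : F, algebraMap F K d ^ 2 = cTildeProd ι a false * cTildeProd ι a true ∧
    algebraMap F K z =
      2 * algebraMap F K d + cTildeProd ι a false + cTildeProd ι a true

/-- The family `c_0 + γ ± u, c_1 - γ ± u, c_2 - γ ± u, …`, indexed by `n` and the sign. -/
noncomputable def signFamily (γ δ u : F) : ℕ × Bool → F
  | (0, s) => orbit γ δ 0 + γ + (if s then u else -u)
  | (n + 1, s) => orbit γ δ (n + 1) - γ + (if s then u else -u)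

end Field

end Arboreal

namespace Arboreal

universe u v

/-! ## Automorphisms of the tree and their portraits -/

/-! The proof combines Kummer theory with the fact that `Omega` is a pro-2 group. For a vertex with
root `β_w`, the two children are `γ ± rad w` with `rad w ^ 2 = β_w + δ`, and a Galois automorphism
carries `rad w` to `rad` of the image vertex with the sign given by the digit `swap`
(`Labeling.map_rad`). The product of all `rad w` of level `i` is therefore a square root of `c_i` on
which Galois acts through `φ_i`. So `c_b` is a square exactly when the image lies in `M b`.

It remains to decide when a closed subgroup of `M a` is all of `M a`. On each finite level `M a`
acts through a finite 2-group, in which every proper subgroup lies in one of index 2. Hence a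
subgroup on which no nonzero finite-level character `M a → ZMod 2` vanishes is dense
(`exists_agree_of_levelChar`). The Galois image is closed by compactness
(`Labeling.mem_imRho_of_forall_agree`), so it is then equal to `M a`.

The core is the list of these characters. Up to any finite level, `M a` is generated by the elements
`flip w` with `a_{|w|} = 0` and the products of two flips with `a_{|w|} = 1` (`LevelChar.eq_zero`),
and conjugation inside `M a` identifies most of these. If `a_0 = 1` and `a ≠ e_0`, only combinations
of the `φ_i` remain. If `a_0 = 0`, there is one more character `psi`, the contribution to `∑ a_i
φ_i` of one half of the tree. If `a = e_0`, both halves are fixed and the characters are the `φ_i`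
of each half separately.

In Kummer terms, `psi` belongs to `c̃_a`, up to a multiple of `φ_0`. Indeed `c̃_a` is the square of
`r_x ± r_y`, where `r_s` is a square root of `c̃_a(s)`. The characters of the two halves belong to
the elements `c_0 + γ ± u` and `c_n - γ ± u`. The conditions of the theorem say precisely that no
character outside the zero class vanishes on the image. Stability follows from transitivity of `M a`
on the relevant sets of roots. -/

theorem zmod_two_cases (e : ZMod 2) : e = 0 ∨ e = 1 := by
  revert e; decide

theorem Omega.mul_apply (σ τ : Omega) (w : Word) : (σ * τ) w = σ (τ w) := rfl

theorem Omega.map_cons_swap (σ : Omega) (s : Bool) (w : Word) :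
    σ (s :: w) = (xor s (decide (swap σ w = 1))) :: σ w := by
  rw [σ.map_cons_eq]
  unfold swap
  split <;> simp_all

theorem Omega.ext_swap {σ τ : Omega} (h : ∀ w, swap σ w = swap τ w) : σ = τ := by
  apply RelIso.ext
  intro w
  induction w with
  | nil => rw [σ.map_nil, τ.map_nil]
  | cons s w ih => rw [σ.map_cons_swap, τ.map_cons_swap, ih, h]

/-- Two automorphisms with the same portrait below level `n` agree on the words of length at most
`n`. -/
theorem Omega.map_eq_of_swap_eq {σ τ : Omega} {n : ℕ}
    (h : ∀ w : Word, w.length < n → swap σ w = swap τ w) :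
    ∀ w : Word, w.length ≤ n → σ w = τ w := by
  intro w
  induction w with
  | nil => intro _; rw [σ.map_nil, τ.map_nil]
  | cons s w ih =>
    intro hw
    rw [List.length_cons] at hw
    rw [σ.map_cons_swap, τ.map_cons_swap, ih (by omega), h w (by omega)]

theorem swap_one (w : Word) : swap 1 w = 0 := if_pos rfl

/-- The map on words with a given portrait. -/
def portraitFun (p : Word → ZMod 2) : Word → Word
  | [] => []
  | s :: w => (xor s (decide (p w = 1))) :: portraitFun p w

/-- The inverse of the map on words with a given portrait. -/
def portraitInv (p : Word → ZMod 2) : Word → Word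
  | [] => []
  | s :: w => (xor s (decide (p (portraitInv p w) = 1))) :: portraitInv p w

/-- The automorphism of the tree with a given portrait. -/
def ofPortrait (p : Word → ZMod 2) : Omega where
  toFun := portraitFun p
  invFun := portraitInv p
  left_inv w := by
    induction w with
    | nil => rfl
    | cons s w ih => simp [portraitFun, portraitInv, ih]
  right_inv w := by
    induction w with
    | nil => rfl
    | cons s w ih => simp [portraitFun, portraitInv, ih]
  map_rel_iff' := by
    intro a b
    constructor
    · rintro ⟨s, hs⟩
      cases b with
      | nil => simp [portraitFun] at hs
      | cons t b =>
        simp only [Equiv.coe_fn_mk, portraitFun, List.cons.injEq] at hs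
        refine ⟨t, ?_⟩
        have hinv : ∀ w, portraitInv p (portraitFun p w) = w := by
          intro w
          induction w with
          | nil => rfl
          | cons s w ih => simp [portraitFun, portraitInv, ih]
        rw [← hinv a, ← hinv b, hs.2]
    · rintro ⟨s, rfl⟩
      exact ⟨_, rfl⟩

theorem swap_ofPortrait (p : Word → ZMod 2) (w : Word) : swap (ofPortrait p) w = p w := by
  have h : ofPortrait p (false :: w) = (decide (p w = 1)) :: ofPortrait p w := by
    change (xor false (decide (p w = 1))) :: _ = _
    rw [Bool.false_xor]; rfl
  unfold swap
  rw [h]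
  rcases zmod_two_cases (p w) with h | h <;> simp [h]

/-- The automorphism exchanging the letters above the word `w`, with trivial portrait elsewhere. -/
def flip (w : Word) : Omega := ofPortrait fun v => if v = w then 1 else 0

/-- The automorphism that exchanges, above the word `v`, the letters at the heights where `m`
is `1`. -/
def mask (v : Word) (m : ℕ → ZMod 2) : Omega :=
  ofPortrait fun u => if v <:+ u then m u.length else 0

theorem swap_flip (w v : Word) : swap (flip w) v = if v = w then 1 else 0 := swap_ofPortrait _ _

theorem swap_mask (v : Word) (m : ℕ → ZMod 2) (u : Word) :
    swap (mask v m) u = if v <:+ u then m u.length else 0 := swap_ofPortrait _ _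

theorem flip_apply_of_length_le (w : Word) {v : Word} (h : v.length ≤ w.length) :
    flip w v = v := by
  refine Omega.map_eq_of_swap_eq (σ := flip w) (τ := 1) (n := w.length) ?_ v h
  intro u hu
  rw [swap_flip, swap_one, if_neg]
  rintro rfl
  exact lt_irrefl _ hu

theorem mask_apply_of_length_le (w : Word) (m : ℕ → ZMod 2) {v : Word}
    (h : v.length ≤ w.length) : mask w m v = v := by
  refine Omega.map_eq_of_swap_eq (σ := mask w m) (τ := 1) (n := w.length) ?_ v h
  intro u hu
  rw [swap_mask, swap_one, if_neg]
  intro h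
  exact absurd h.length_le (by omega)

theorem Omega.suffix_map (σ : Omega) {v w : Word} (h : v <:+ w) : σ v <:+ σ w := by
  obtain ⟨u, rfl⟩ := h
  induction u with
  | nil => exact List.suffix_refl _
  | cons s u ih =>
    rw [List.cons_append, σ.map_cons_swap]
    exact ih.trans (List.suffix_cons _ _)

theorem Omega.suffix_map_iff (σ : Omega) {v w : Word} : σ v <:+ σ w ↔ v <:+ w := by
  refine ⟨fun h => ?_, σ.suffix_map⟩
  have := Omega.suffix_map σ⁻¹ h
  simpa only [← Omega.mul_apply, inv_mul_cancel, RelIso.coe_one, id] using this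

theorem suffix_iff_of_map_eq {σ : Omega} {v : Word} (h : σ v = v) (w : Word) :
    v <:+ σ w ↔ v <:+ w := by
  conv_lhs => rw [← h]
  exact σ.suffix_map_iff

theorem flip_mul_flip (w : Word) : flip w * flip w = 1 := by
  apply Omega.ext_swap
  intro v
  rw [swap_mul, swap_one, swap_flip, swap_flip]
  have hw := flip_apply_of_length_le w (le_refl w.length)
  have : flip w v = w ↔ v = w :=
    ⟨fun h => (flip w).injective (h.trans hw.symm), fun h => by rw [h, hw]⟩
  simp only [this]
  split <;> decide

theorem flip_inv (w : Word) : (flip w)⁻¹ = flip w :=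
  inv_eq_of_mul_eq_one_left (flip_mul_flip w)

/-- A commutation rule for automorphisms with the same portrait over the two children of `w`. -/
theorem mul_flip {σ : Omega} {w : Word} (h : ∀ v, swap σ (flip w v) = swap σ v) :
    σ * flip w = flip (σ w) * σ := by
  apply Omega.ext_swap
  intro v
  rw [swap_mul, swap_mul, h, swap_flip, swap_flip, add_comm]
  simp only [σ.injective.eq_iff]

/-- The portrait of `flip v` is concentrated at `v`, which `flip w` fixes when `w` is at least as
long. Conjugating by `flip v` therefore only moves the place of the flip. -/
theorem flip_mul_flip_comm {v w : Word} (h : v.length ≤ w.length) :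
    flip v * flip w = flip (flip v w) * flip v := by
  apply mul_flip
  intro u
  rw [swap_flip, swap_flip]
  have hv := flip_apply_of_length_le w h
  have : flip w u = v ↔ u = v :=
    ⟨fun h => (flip w).injective (h.trans hv.symm), fun h => by rw [h, hv]⟩
  simp only [this]

/-- The portrait of `mask v m` depends only on the length of a word and on whether it lies above
`v`; `flip w` preserves both. Masks thus conjugate flips to flips. -/
theorem mask_mul_flip {v w : Word} (m : ℕ → ZMod 2) (h : v.length ≤ w.length) :
    mask v m * flip w = flip (mask v m w) * mask v m := by
  apply mul_flip
  intro u
  rw [swap_mask, swap_mask, Omega.length_map,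
    if_congr (suffix_iff_of_map_eq (flip_apply_of_length_le w h) u) rfl rfl]

/-- The automorphism `flip v` fixes the words of which `v` is not a proper suffix. -/
theorem flip_apply_of_not_suffix {v : Word} : ∀ {w : Word}, ¬ v <:+ w → flip v w = w := by
  intro w
  induction w with
  | nil => intro _; exact Omega.map_nil _
  | cons s w ih =>
    intro h
    have h' : ¬ v <:+ w := fun h1 => h (h1.trans (List.suffix_cons s w))
    rw [Omega.map_cons_swap, ih h', swap_flip,
      if_neg (by rintro rfl; exact h' (List.suffix_refl _))]
    simp

theorem flip_comm_of_not_suffix {v w : Word} (h : ¬ v <:+ w) (h' : ¬ w <:+ v) :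
    flip v * flip w = flip w * flip v := by
  rcases le_total v.length w.length with hl | hl
  · rw [flip_mul_flip_comm hl, flip_apply_of_not_suffix h]
  · rw [flip_mul_flip_comm hl, flip_apply_of_not_suffix h']

/-- The automorphisms `mask v m` act transitively on the words of a given length above `v`. -/
theorem exists_mask (v : Word) {w w' : Word} (hl : w.length = w'.length) (h : v <:+ w)
    (h' : v <:+ w') : ∃ m : ℕ → ZMod 2, mask v m w = w' := by
  obtain ⟨u, rfl⟩ := h
  obtain ⟨u', rfl⟩ := h'
  induction u generalizing u' with
  | nil =>
    obtain rfl : u' = [] := by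
      rw [← List.length_eq_zero_iff]; simp at hl; simp [hl]
    exact ⟨0, mask_apply_of_length_le v 0 le_rfl⟩
  | cons s u ih =>
    cases u' with
    | nil => simp at hl; omega
    | cons s' u' =>
      have hl' : (u ++ v).length = (u' ++ v).length := by simpa using hl
      obtain ⟨m, hm⟩ := ih u' hl'
      refine ⟨Function.update m (u ++ v).length (if s = s' then 0 else 1), ?_⟩
      rw [List.cons_append, List.cons_append, Omega.map_cons_swap, swap_mask,
        if_pos (List.suffix_append u v), Function.update_self,
        Omega.map_eq_of_swap_eq (τ := mask v m) (n := (u ++ v).length) ?_ _ le_rfl, hm]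
      · cases s <;> cases s' <;> simp
      · intro x hx
        rw [swap_mask, swap_mask, Function.update_of_ne hx.ne]

/-! ## The characters of the tree -/

/-- The sum of the digits of `σ` over the words of length `i` above `v`. -/
def phiAt (v : Word) (i : ℕ) (σ : Omega) : ZMod 2 :=
  ∑ w : List.Vector Bool i, if v <:+ w.toList then swap σ w.toList else 0

theorem phiAt_nil (i : ℕ) (σ : Omega) : phiAt [] i σ = phi i σ :=
  Finset.sum_congr rfl fun _ _ => if_pos List.nil_suffix

/-- Since `τ` carries the words above `v` to those above `τ v`, this is only a cocycle identity; it
gives a homomorphism on the stabilizer of `v`. -/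
theorem phiAt_mul (v : Word) (i : ℕ) (σ τ : Omega) :
    phiAt v i (σ * τ) = phiAt (τ v) i σ + phiAt v i τ := by
  unfold phiAt
  rw [← Equiv.sum_comp (levelPerm τ i)
    (fun w => if τ v <:+ w.toList then swap σ w.toList else 0), ← Finset.sum_add_distrib]
  refine Finset.sum_congr rfl fun w _ => ?_
  change _ = (if τ v <:+ τ w.toList then swap σ (τ w.toList) else 0) + _
  simp only [τ.suffix_map_iff, swap_mul]
  split <;> simp

/-- The last letter of a nonempty word tells in which of the two halves of the tree it lies;
disjointness of the halves is what makes flips in different halves commute. -/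
theorem suffix_singleton_iff (s : Bool) (w : Word) (hw : w ≠ []) :
    [s] <:+ w ↔ ¬ [!s] <:+ w := by
  obtain ⟨u, t, rfl⟩ : ∃ u t, w = u ++ [t] := ⟨_, _, (List.dropLast_append_getLast hw).symm⟩
  have : ∀ s : Bool, [s] <:+ u ++ [t] ↔ s = t := by
    intro s
    constructor
    · rintro ⟨u', hu'⟩
      have := congrArg List.getLast? hu'
      simpa using this
    · rintro rfl; exact List.suffix_append _ _
  rw [this, this]
  cases s <;> cases t <;> simp

theorem exists_suffix_singleton (w : Word) (hw : w ≠ []) : ∃ s, [s] <:+ w :=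
  ⟨w.getLast hw, w.dropLast, List.dropLast_append_getLast hw⟩

theorem phiAt_add_phiAt {i : ℕ} (hi : i ≠ 0) (σ : Omega) :
    phiAt [false] i σ + phiAt [true] i σ = phi i σ := by
  unfold phiAt phi
  rw [← Finset.sum_add_distrib]
  refine Finset.sum_congr rfl fun w _ => ?_
  have hw : w.toList ≠ [] := by
    intro h
    have := congrArg List.length h
    rw [List.Vector.toList_length] at this
    exact hi this
  have := suffix_singleton_iff false w.toList hw
  by_cases h : [true] <:+ w.toList
  · have h1 : ¬ [false] <:+ w.toList := by rw [this]; simpa using h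
    simp [h, h1]
  · have h1 : [false] <:+ w.toList := by rw [this]; simpa using h
    simp [h, h1]

theorem phiAt_flip (v : Word) (i : ℕ) (w : Word) :
    phiAt v i (flip w) = if w.length = i ∧ v <:+ w then 1 else 0 := by
  unfold phiAt
  by_cases h : w.length = i
  · subst h
    let w' : List.Vector Bool w.length := ⟨w, rfl⟩
    refine (Finset.sum_eq_single w' ?_ ?_).trans ?_
    · intro u _ hu
      have : u.toList ≠ w := fun h => hu (Subtype.ext h)
      simp [swap_flip, this]
    · intro h; exact absurd (Finset.mem_univ _) h
    · change (if v <:+ w then swap (flip w) w else 0) = _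
      simp [swap_flip]
  · rw [if_neg (fun h' => h h'.1)]
    refine Finset.sum_eq_zero fun u _ => ?_
    have : u.toList ≠ w := by
      intro hu; apply h; rw [← hu, List.Vector.toList_length]
    simp [swap_flip, this]

theorem phi_flip (i : ℕ) (w : Word) : phi i (flip w) = if w.length = i then 1 else 0 := by
  rw [← phiAt_nil, phiAt_flip]; simp

theorem phiAt_congr {n i : ℕ} (hi : i < n) (v : Word) {σ τ : Omega}
    (h : ∀ w : Word, w.length < n → swap σ w = swap τ w) : phiAt v i σ = phiAt v i τ :=
  Finset.sum_congr rfl fun w _ => by rw [h w.toList (by rw [List.Vector.toList_length]; exact hi)]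

/-- The character `∑ a_i φ_i`. -/
def phiSum (a : ℕ →₀ ZMod 2) (σ : Omega) : ZMod 2 := a.sum fun i e => e * phi i σ

theorem mem_M {a : ℕ →₀ ZMod 2} {σ : Omega} : σ ∈ M a ↔ phiSum a σ = 0 := Iff.rfl

theorem phiSum_mul (a : ℕ →₀ ZMod 2) (σ τ : Omega) :
    phiSum a (σ * τ) = phiSum a σ + phiSum a τ := by
  simp only [phiSum, phi_mul, mul_add, Finsupp.sum_add]

theorem phiSum_flip (a : ℕ →₀ ZMod 2) (w : Word) : phiSum a (flip w) = a w.length := by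
  unfold phiSum
  simp only [phi_flip, mul_ite, mul_one, mul_zero]
  rw [Finsupp.sum_ite_eq]
  split
  · rfl
  · exact (Finsupp.notMem_support_iff.1 ‹_›).symm

theorem phiSum_congr {n : ℕ} {a : ℕ →₀ ZMod 2} (ha : ∀ i, a i ≠ 0 → i < n) {σ τ : Omega}
    (h : ∀ w : Word, w.length < n → swap σ w = swap τ w) : phiSum a σ = phiSum a τ := by
  refine Finset.sum_congr rfl fun i hi => ?_
  simp only
  rw [← phiAt_nil, ← phiAt_nil, phiAt_congr (ha i (Finsupp.mem_support_iff.1 hi)) [] h]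

theorem phiSum_single (i : ℕ) (σ : Omega) : phiSum (Finsupp.single i 1) σ = phi i σ := by
  simp [phiSum]

theorem flip_mem_M {a : ℕ →₀ ZMod 2} {w : Word} : flip w ∈ M a ↔ a w.length = 0 := by
  rw [mem_M, phiSum_flip]

theorem zmod_two_eq_one {e : ZMod 2} : e ≠ 0 ↔ e = 1 := by
  rcases zmod_two_cases e with rfl | rfl <;> simp

/-- `M a` has index at most 2. This allows a conjugating element outside `M a` to be corrected by a
harmless flip that also lies outside. -/
theorem mul_mem_M_of_notMem {a : ℕ →₀ ZMod 2} {σ τ : Omega} (hσ : σ ∉ M a) (hτ : τ ∉ M a) :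
    σ * τ ∈ M a := by
  rw [mem_M] at *
  rw [phiSum_mul, zmod_two_eq_one.1 hσ, zmod_two_eq_one.1 hτ]
  decide

theorem exists_bound (a : ℕ →₀ ZMod 2) : ∃ n, ∀ i, a i ≠ 0 → i < n := by
  refine ⟨a.support.sup id + 1, fun i hi => ?_⟩
  exact Nat.lt_succ_of_le (Finset.le_sup (f := id) (Finsupp.mem_support_iff.2 hi))

theorem phi_zero_eq (σ : Omega) : phi 0 σ = swap σ [] := by
  have : phi 0 σ = ∑ w : List.Vector Bool 0, swap σ [] :=
    Finset.sum_congr rfl fun w _ => by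
      rw [List.Vector.eq_nil w]; rfl
  rw [this]
  simp

theorem phi_zero_of_map_singleton {σ : Omega} : phi 0 σ = 0 ↔ ∀ s, σ [s] = [s] := by
  rw [phi_zero_eq]
  constructor
  · intro h s
    rw [σ.map_cons_swap, h, σ.map_nil]; simp
  · intro h
    exact if_pos (by rw [h, σ.map_nil])

/-- The portrait of `mask [] m` is constant on each level, and a level `i ≠ 0` has an even number of
words. -/
theorem phi_mask_nil (m : ℕ → ZMod 2) {i : ℕ} (hi : i ≠ 0) : phi i (mask [] m) = 0 := by
  unfold phi
  simp only [swap_mask, List.nil_suffix, if_true, List.Vector.toList_length, Finset.sum_const,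
    Finset.card_univ, card_vector, Fintype.card_bool, nsmul_eq_mul]
  obtain ⟨j, rfl⟩ := Nat.exists_eq_succ_of_ne_zero hi
  have : (2 : ZMod 2) = 0 := by decide
  simp [pow_succ, this]

theorem mask_nil_mem_M {a : ℕ →₀ ZMod 2} (ha : a 0 = 0) (m : ℕ → ZMod 2) : mask [] m ∈ M a := by
  rw [mem_M]
  refine Finset.sum_eq_zero fun i hi => ?_
  rcases eq_or_ne i 0 with rfl | h
  · simp only [ha, zero_mul]
  · simp only [phi_mask_nil m h, mul_zero]

theorem mask_apply_of_not_suffix {v : Word} (m : ℕ → ZMod 2) :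
    ∀ {w : Word}, ¬ v <:+ w → mask v m w = w := by
  intro w
  induction w with
  | nil => intro _; exact Omega.map_nil _
  | cons s w ih =>
    intro h
    have h' : ¬ v <:+ w := fun h1 => h (h1.trans (List.suffix_cons s w))
    rw [Omega.map_cons_swap, ih h', swap_mask, if_neg h']
    simp

theorem not_suffix_of_singleton {s : Bool} {v w : Word} (hv : [!s] <:+ v) (hw : [s] <:+ w) :
    ¬ v <:+ w := fun h => by
  have hne : w ≠ [] := by rintro rfl; simp at hw
  exact (suffix_singleton_iff s w hne).1 hw (hv.trans h)

theorem flip_comm_of_singleton {s : Bool} {v w : Word} (hv : [!s] <:+ v) (hw : [s] <:+ w) :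
    flip v * flip w = flip w * flip v :=
  flip_comm_of_not_suffix (not_suffix_of_singleton hv hw)
    (not_suffix_of_singleton (s := !s) (by simpa using hw) hv)

theorem singleton_suffix_replicate {k : ℕ} (hk : k ≠ 0) (s : Bool) :
    [s] <:+ List.replicate k s := by
  obtain ⟨j, rfl⟩ := Nat.exists_eq_succ_of_ne_zero hk
  rw [List.replicate_succ']
  exact List.suffix_append _ _

theorem flip_mul_cancel (v w : Word) (σ : Omega) :
    (flip v * flip w) * (flip w * σ) = flip v * σ := by
  rw [mul_assoc, ← mul_assoc (flip w), flip_mul_flip, one_mul]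

theorem pair_mem_M {a : ℕ →₀ ZMod 2} {v w : Word} (hv : a v.length = 1) (hw : a w.length = 1) :
    flip v * flip w ∈ M a := by
  refine mul_mem_M_of_notMem ?_ ?_ <;> rw [flip_mem_M] <;> simp [*]

/-! ## Characters of the subgroups `M a` that factor through a finite level -/

/-- `χ` restricts to a homomorphism on `M a` that factors through the action on the words of length
at most `n`, a level beyond the support of `a`. -/
structure LevelChar (a : ℕ →₀ ZMod 2) (n : ℕ) (χ : Omega → ZMod 2) : Prop where
  bound : ∀ i, a i ≠ 0 → i < n
  map_mul : ∀ σ ∈ M a, ∀ τ ∈ M a, χ (σ * τ) = χ σ + χ τ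
  congr : ∀ σ ∈ M a, ∀ τ ∈ M a,
    (∀ w : Word, w.length < n → swap σ w = swap τ w) → χ σ = χ τ

namespace LevelChar

variable {a : ℕ →₀ ZMod 2} {n : ℕ} {χ χ' : Omega → ZMod 2}

theorem map_one (h : LevelChar a n χ) : χ 1 = 0 := by
  have := h.map_mul 1 (one_mem _) 1 (one_mem _)
  rw [mul_one] at this
  simpa using this

theorem map_inv (h : LevelChar a n χ) {σ : Omega} (hσ : σ ∈ M a) : χ σ⁻¹ = χ σ := by
  have := h.map_mul σ hσ σ⁻¹ (inv_mem hσ)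
  rw [mul_inv_cancel, h.map_one] at this
  exact (CharTwo.add_eq_zero.1 this.symm).symm

theorem add (h : LevelChar a n χ) (h' : LevelChar a n χ') :
    LevelChar a n fun σ => χ σ + χ' σ where
  bound := h.bound
  map_mul σ hσ τ hτ := by rw [h.map_mul σ hσ τ hτ, h'.map_mul σ hσ τ hτ]; abel
  congr σ hσ τ hτ hw := by rw [h.congr σ hσ τ hτ hw, h'.congr σ hσ τ hτ hw]

theorem const_mul (h : LevelChar a n χ) (e : ZMod 2) : LevelChar a n fun σ => e * χ σ where
  bound := h.bound
  map_mul σ hσ τ hτ := by rw [h.map_mul σ hσ τ hτ, mul_add]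
  congr σ hσ τ hτ hw := by rw [h.congr σ hσ τ hτ hw]

theorem map_eq_of_conj (h : LevelChar a n χ) {σ η η' : Omega} (hσ : σ ∈ M a) (hη : η ∈ M a)
    (hη' : η' ∈ M a) (he : σ * η = η' * σ) : χ η = χ η' := by
  have := congrArg χ he
  rw [h.map_mul σ hσ η hη, h.map_mul η' hη' σ hσ, add_comm] at this
  exact add_right_cancel this

/-- The kernel of the restriction of the character to `M a`. -/
def ker (h : LevelChar a n χ) : Subgroup Omega where
  carrier := {σ | σ ∈ M a ∧ χ σ = 0}
  one_mem' := ⟨one_mem _, h.map_one⟩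
  mul_mem' {σ τ} hσ hτ := ⟨mul_mem hσ.1 hτ.1, by
    rw [h.map_mul σ hσ.1 τ hτ.1, hσ.2, hτ.2, add_zero]⟩
  inv_mem' {σ} hσ := ⟨inv_mem hσ.1, by rw [h.map_inv hσ.1, hσ.2]⟩

/-- The elements `flip w` and `flip w * flip w₀` in `M a` generate `M a` topologically. -/
theorem eq_zero (h : LevelChar a n χ) {w₀ : Word} (hw₀ : a w₀.length = 1)
    (h1 : ∀ w : Word, w.length < n → a w.length = 0 → χ (flip w) = 0)
    (h2 : ∀ w : Word, a w.length = 1 → χ (flip w * flip w₀) = 0) :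
    ∀ σ ∈ M a, χ σ = 0 := by
  have k1 : ∀ w : Word, w.length < n → a w.length = 0 → flip w ∈ h.ker :=
    fun w hw ha => ⟨flip_mem_M.2 ha, h1 w hw ha⟩
  have k2 : ∀ w : Word, a w.length = 1 → flip w * flip w₀ ∈ h.ker :=
    fun w ha => ⟨pair_mem_M ha hw₀, h2 w ha⟩
  have k3 : ∀ w : Word, a w.length = 1 → flip w₀ * flip w ∈ h.ker := fun w ha => by
    have := inv_mem (k2 w ha)
    rwa [mul_inv_rev, flip_inv, flip_inv] at this
  -- The kernel must also absorb conjugates of single flips by `flip w₀`, because a stray `flip w₀`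
  -- may stand between the generators. The shorter of the two words decides which commutation rule
  -- applies.
  have k4 : ∀ w : Word, w.length < n → a w.length = 0 →
      flip w₀ * flip w * flip w₀ ∈ h.ker := by
    intro w hw ha
    rcases le_total w₀.length w.length with hl | hl
    · rw [flip_mul_flip_comm hl, mul_assoc, flip_mul_flip, mul_one]
      apply k1 <;> rwa [Omega.length_map]
    · have e : flip (flip w w₀) * flip w = flip w * flip w₀ := (flip_mul_flip_comm hl).symm
      rw [mul_assoc, ← e, ← mul_assoc]
      refine mul_mem (k3 _ ?_) (k1 w hw ha)
      rwa [Omega.length_map]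
  -- An element with finite portrait `S` is a product of flips, ordered by length. The induction
  -- records whether an unpaired flip is left over, in which case `flip w₀` completes it.
  have key : ∀ S : Finset Word, (∀ w ∈ S, w.length < n) →
      ofPortrait (fun v => if v ∈ S then 1 else 0) ∈ h.ker ∨
      ofPortrait (fun v => if v ∈ S then 1 else 0) * flip w₀ ∈ h.ker := by
    intro S
    refine Finset.induction_on_max_value List.length S ?_ ?_
    · intro _
      left
      convert one_mem h.ker
      exact Omega.ext_swap fun w => by rw [swap_ofPortrait, swap_one]; simp
    · intro w S hwS hmax ih hS
      have hw : List.length w < n := hS w (Finset.mem_insert_self _ _)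
      have e : ofPortrait (fun v => if v ∈ (insert w S : Finset Word) then 1 else 0) =
          ofPortrait (fun v => if v ∈ S then 1 else 0) * flip w := by
        apply Omega.ext_swap
        intro v
        rw [swap_mul, swap_ofPortrait, swap_ofPortrait, swap_flip]
        -- As `w` has maximal length, `flip w` fixes every word that is no longer than `w`, and no
        -- longer word is in `S`.
        have hv : flip w v ∈ S ↔ v ∈ S := by
          rcases le_or_gt v.length w.length with hl | hl
          · rw [flip_apply_of_length_le w hl]
          · refine iff_of_false (fun h => ?_) (fun h => ?_)
            · have := hmax _ h
              rw [Omega.length_map] at this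
              omega
            · have := hmax _ h
              omega
        simp only [hv, Finset.mem_insert]
        by_cases hvw : v = w
        · subst hvw; simp [hwS]
        · simp [hvw]
      rw [e]
      generalize ofPortrait (fun v => if v ∈ S then 1 else 0) = P at ih
      rcases ih fun v hv => hS v (Finset.mem_insert_of_mem hv) with hP | hP <;>
        rcases zmod_two_cases (a w.length) with ha | ha
      · exact Or.inl (mul_mem hP (k1 w hw ha))
      · right; rw [mul_assoc]; exact mul_mem hP (k2 w ha)
      · right
        have := mul_mem hP (k4 w hw ha)
        rwa [mul_assoc, mul_assoc, ← mul_assoc (flip w₀), flip_mul_flip, one_mul,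
          ← mul_assoc] at this
      · left
        have := mul_mem hP (k3 w ha)
        rwa [mul_assoc, ← mul_assoc (flip w₀), flip_mul_flip, one_mul] at this
  intro σ hσ
  let S := (List.finite_length_lt Bool n).toFinset.filter (fun w => swap σ w = 1)
  have hS : ∀ w ∈ S, w.length < n := fun w hw => by
    simpa using (Finset.mem_filter.1 hw).1
  have hag : ∀ w : Word, w.length < n →
      swap σ w = swap (ofPortrait (fun v => if v ∈ S then 1 else 0)) w := by
    intro w hw
    have : w ∈ S ↔ swap σ w = 1 := by simp [S, hw]
    rw [swap_ofPortrait, if_congr this rfl rfl]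
    rcases zmod_two_cases (swap σ w) with h | h <;> simp [h]
  have hmem : ofPortrait (fun v => if v ∈ S then 1 else 0) ∈ M a := by
    rw [mem_M, ← phiSum_congr h.bound hag]; exact hσ
  rw [h.congr σ hσ _ hmem hag]
  rcases key S hS with hk | hk
  · exact hk.2
  · exfalso
    -- The unpaired case cannot occur for an element of `M a`, since `flip w₀` would lie in `M a`
    -- too.
    have : flip w₀ ∈ M a := (Subgroup.mul_mem_cancel_left _ hmem).1 hk.1
    rw [flip_mem_M, hw₀] at this
    exact one_ne_zero this

/-! ### Values of a character on the generators -/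

theorem pair_comm (h : LevelChar a n χ) {v w : Word} (hv : a v.length = 1)
    (hw : a w.length = 1) : χ (flip v * flip w) = χ (flip w * flip v) := by
  rw [← h.map_inv (pair_mem_M hv hw), mul_inv_rev, flip_inv, flip_inv]

/-- The two inner flips cancel, so values on pairs telescope and may be routed through any third
word with coefficient 1. -/
theorem pair_add (h : LevelChar a n χ) {u v w : Word} (hu : a u.length = 1)
    (hv : a v.length = 1) (hw : a w.length = 1) :
    χ (flip u * flip w) = χ (flip u * flip v) + χ (flip v * flip w) := by
  rw [← h.map_mul _ (pair_mem_M hu hv) _ (pair_mem_M hv hw), flip_mul_cancel]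

/-- A mask over `[s]` moves `w` to `w'` and does not touch a word `v` of the same length in the
other half. Conjugation turns the pair `w, v` into `w', v`; telescoping through `v` gives twice one
value. -/
theorem pair_eq_zero (h : LevelChar a n χ) {s : Bool} {w w' : Word} (hl : w.length = w'.length)
    (ha : a w.length = 1) (hw : [s] <:+ w) (hw' : [s] <:+ w') : χ (flip w * flip w') = 0 := by
  obtain ⟨m, hm⟩ := exists_mask [s] hl hw hw'
  set τ := mask [s] m
  obtain ⟨v, hvl, hv⟩ : ∃ v : Word, v.length = w.length ∧ [!s] <:+ v := by
    refine ⟨List.replicate w.length (!s), by simp, singleton_suffix_replicate ?_ _⟩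
    have := hw.length_le
    simp at this; omega
  have hav : a v.length = 1 := hvl ▸ ha
  have haw' : a w'.length = 1 := hl ▸ ha
  have hτv : τ v = v := mask_apply_of_not_suffix m fun hs =>
    not_suffix_of_singleton (s := !s) (by simpa using hs) hv (List.suffix_refl _)
  have e1 : τ * flip w = flip w' * τ := by rw [mask_mul_flip m hw.length_le, hm]
  have e2 : τ * flip v = flip v * τ := by
    rw [mask_mul_flip m (hv.length_le.trans' (by simp)), hτv]
  have e3 : flip w * flip v = flip v * flip w := (flip_comm_of_singleton hv hw).symm
  have e : χ (flip w * flip v) = χ (flip w' * flip v) := by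
    by_cases hτ : τ ∈ M a
    · refine h.map_eq_of_conj hτ (pair_mem_M ha hav) (pair_mem_M haw' hav) ?_
      rw [← mul_assoc, e1, mul_assoc, e2, ← mul_assoc]
    -- If the mask is not in `M a`, then its product with `flip v` is. It conjugates in the same way
    -- because `flip v` commutes with `flip w` and with the mask.
    · have hv' : flip v ∉ M a := by rw [flip_mem_M]; simp [hav]
      refine h.map_eq_of_conj (mul_mem_M_of_notMem hτ hv') (pair_mem_M ha hav)
        (pair_mem_M haw' hav) ?_
      calc τ * flip v * (flip w * flip v) = τ * flip w * (flip v * flip v) := by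
            rw [e3, mul_assoc, ← mul_assoc (flip v), flip_mul_flip, one_mul, mul_one]
        _ = flip w' * τ := by rw [flip_mul_flip, mul_one, e1]
        _ = flip w' * flip v * (τ * flip v) := by
            rw [e2, flip_mul_cancel]
  rw [h.pair_add ha hav haw', e, h.pair_comm hav haw']
  exact CharTwo.add_self_eq_zero _

/-- The two flips are conjugate in `Omega` by a mask. If the mask is outside `M a`, it is corrected
by a flip at level `k` in the half not containing `w`, which commutes with `flip w`. -/
theorem map_flip_eq (h : LevelChar a n χ) {k : ℕ} (hk : k ≠ 0) (hak : a k = 1) {w w' : Word}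
    (hl : w.length = w'.length) (ha : a w.length = 0) : χ (flip w) = χ (flip w') := by
  obtain ⟨m, hm⟩ := exists_mask [] hl List.nil_suffix List.nil_suffix
  rcases eq_or_ne w [] with rfl | hne
  · rw [Omega.map_nil] at hm; rw [hm]
  obtain ⟨s, hs⟩ := exists_suffix_singleton w hne
  set τ := mask [] m
  have hv := singleton_suffix_replicate hk (!s)
  set v := List.replicate k (!s)
  have hav : a v.length = 1 := by simpa [v] using hak
  have ha' : a w'.length = 0 := hl ▸ ha
  have e1 : τ * flip w = flip w' * τ := by rw [mask_mul_flip m (Nat.zero_le _), hm]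
  by_cases hτ : τ ∈ M a
  · exact h.map_eq_of_conj hτ (flip_mem_M.2 ha) (flip_mem_M.2 ha') e1
  · have hv' : flip v ∉ M a := by rw [flip_mem_M]; simp [hav]
    refine h.map_eq_of_conj (mul_mem_M_of_notMem hτ hv') (flip_mem_M.2 ha) (flip_mem_M.2 ha') ?_
    rw [mul_assoc, flip_comm_of_singleton hv hs, ← mul_assoc, e1, mul_assoc]

end LevelChar

/-! ### The lists of characters of `M a` -/

theorem levelChar_phiSum {a b : ℕ →₀ ZMod 2} {n : ℕ} (ha : ∀ i, a i ≠ 0 → i < n)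
    (hb : ∀ i, b i ≠ 0 → i < n) : LevelChar a n (phiSum b) where
  bound := ha
  map_mul σ _ τ _ := phiSum_mul b σ τ
  congr _ _ _ _ h := phiSum_congr hb h

/-- The part of the character `∑ a_i φ_i` coming from the words that end in the letter `s`. -/
def psi (a : ℕ →₀ ZMod 2) (s : Bool) (σ : Omega) : ZMod 2 := a.sum fun i e => e * phiAt [s] i σ

theorem psi_mul (a : ℕ →₀ ZMod 2) {s t : Bool} (σ : Omega) {τ : Omega} (h : τ [s] = [t]) :
    psi a s (σ * τ) = psi a t σ + psi a s τ := by
  simp only [psi, phiAt_mul, mul_add, Finsupp.sum_add, h]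

theorem psi_add_psi {a : ℕ →₀ ZMod 2} (ha : a 0 = 0) (σ : Omega) :
    psi a false σ + psi a true σ = phiSum a σ := by
  unfold psi phiSum
  rw [← Finsupp.sum_add]
  refine Finset.sum_congr rfl fun i hi => ?_
  have : i ≠ 0 := by rintro rfl; exact Finsupp.mem_support_iff.1 hi ha
  simp only [← mul_add, phiAt_add_phiAt this]

/-- On `M a` the contributions of the two halves add up to zero. Hence it does not matter which half
is taken, and `psi` is additive even on elements that exchange the halves. -/
theorem psi_eq_psi {a : ℕ →₀ ZMod 2} (ha : a 0 = 0) {σ : Omega} (hσ : σ ∈ M a) (s t : Bool) :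
    psi a s σ = psi a t σ := by
  have := psi_add_psi ha σ
  rw [mem_M.1 hσ, CharTwo.add_eq_zero] at this
  cases s <;> cases t <;> simp [this]

theorem psi_flip (a : ℕ →₀ ZMod 2) (s : Bool) (w : Word) :
    psi a s (flip w) = if [s] <:+ w then a w.length else 0 := by
  unfold psi
  simp only [phiAt_flip]
  by_cases h : [s] <:+ w
  · have := phiSum_flip a w
    simp only [phiSum, phi_flip] at this
    simpa [h] using this
  · simp [h]

theorem levelChar_psi {a : ℕ →₀ ZMod 2} {n : ℕ} (ha0 : a 0 = 0) (ha : ∀ i, a i ≠ 0 → i < n)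
    (s : Bool) : LevelChar a n (psi a s) where
  bound := ha
  map_mul σ hσ τ _ := by
    obtain ⟨t, ht⟩ := τ.map_cons s []
    rw [psi_mul a σ (t := t) (by rw [ht, τ.map_nil]), psi_eq_psi ha0 hσ t s]
  congr σ _ τ _ h := Finset.sum_congr rfl fun i hi => by
    simp only [phiAt_congr (ha i (Finsupp.mem_support_iff.1 hi)) [s] h]

/-- A finitely supported vector with given coefficients below `n`. -/
theorem exists_finsupp (n : ℕ) (c : ℕ → ZMod 2) :
    ∃ b : ℕ →₀ ZMod 2, (∀ i, b i ≠ 0 → i < n) ∧ ∀ i < n, b i = c i := by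
  refine ⟨Finsupp.onFinset (Finset.range n) (fun i => if i < n then c i else 0) ?_, ?_, ?_⟩
  · intro i hi
    by_contra h
    simp_all
  · intro i hi
    by_contra h
    simp_all
  · intro i hi
    simp [hi]

namespace LevelChar

variable {a : ℕ →₀ ZMod 2} {n : ℕ} {χ : Omega → ZMod 2}

theorem pair_add_coeff (h : LevelChar a n χ) {k : ℕ} (hak : a k = 1) {w : Word}
    (hw : a w.length = 1) :
    χ (flip w * flip (List.replicate k false)) =
      χ (flip (List.replicate w.length false) * flip (List.replicate k false)) +
      χ (flip w * flip (List.replicate w.length false)) := by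
  rw [add_comm]
  exact h.pair_add hw (by simpa using hw) (by simpa using hak)

/-- The characters of `M a` for `a 0 = 0`. -/
theorem exists_eq_of_zero (h : LevelChar a n χ) (ha : a ≠ 0) (ha0 : a 0 = 0) :
    ∃ (b : ℕ →₀ ZMod 2) (e : ZMod 2), ∀ σ ∈ M a, χ σ = phiSum b σ + e * psi a true σ := by
  obtain ⟨k, hk⟩ := Finsupp.ne_iff.1 ha
  have hak : a k = 1 := zmod_two_eq_one.1 hk
  have hk0 : k ≠ 0 := by rintro rfl; exact hk ha0
  let U : Word := List.replicate k false
  let V : Word := List.replicate k true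
  have hU : a U.length = 1 := by simpa [U] using hak
  have hV : a V.length = 1 := by simpa [V] using hak
  -- A pair across the two halves is invisible to every `φ_i` when both words have the same length,
  -- but `psi` takes the value 1 on it; so this value must be the coefficient of `psi`.
  let e := χ (flip V * flip U)
  -- The coefficients are read off on the words `x^j`, paired with the reference word `U` where `a_j
  -- = 1`.
  obtain ⟨b, hbn, hb⟩ := exists_finsupp n fun j =>
    if a j = 0 then χ (flip (List.replicate j false))
    else χ (flip (List.replicate j false) * flip U)
  refine ⟨b, e, fun σ hσ => ?_⟩
  rw [← CharTwo.add_eq_zero]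
  refine (h.add ((levelChar_phiSum h.bound hbn).add
    ((levelChar_psi ha0 h.bound true).const_mul e))).eq_zero (w₀ := U) hU ?_ ?_ σ hσ
  · intro w hwn hw
    rw [phiSum_flip, psi_flip, hb _ hwn, hw, ite_self, mul_zero, add_zero, if_pos rfl,
      h.map_flip_eq hk0 hak (w' := List.replicate w.length false) (by simp) hw]
    exact CharTwo.add_self_eq_zero _
  · intro w hw
    have hwn : w.length < n := h.bound _ (by simp [hw])
    have hw0 : w.length ≠ 0 := by intro h0; rw [h0, ha0] at hw; exact zero_ne_one hw
    have hwne : w ≠ [] := by rintro rfl; exact hw0 rfl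
    have hUs := singleton_suffix_replicate hk0 false
    have hUt : ¬ [true] <:+ U := (suffix_singleton_iff false U (by simpa [U] using hk0)).1 hUs
    have hUf : flip U [true] = [true] :=
      flip_apply_of_length_le U (by simp [U]; omega)
    have hbU : b U.length = 0 := by
      rw [hb _ (h.bound _ (by simp [hU])), hU, if_neg one_ne_zero]
      simp only [U, List.length_replicate]
      rw [flip_mul_flip, h.map_one]
    have hbw : b w.length = χ (flip (List.replicate w.length false) * flip U) := by
      rw [hb _ hwn, hw, if_neg one_ne_zero]
    rw [phiSum_mul, phiSum_flip, phiSum_flip, psi_mul a _ hUf, psi_flip, psi_flip, if_neg hUt,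
      hbU, add_zero, add_zero, hw, h.pair_add_coeff hak hw, hbw, mul_ite, mul_one, mul_zero]
    -- Only the half containing `w` matters. A pair across the halves has the same value `e` at
    -- every level of the support.
    have key : χ (flip w * flip (List.replicate w.length false)) =
        if [true] <:+ w then e else 0 := by
      split_ifs with hs
      · have hW : a (List.replicate w.length true).length = 1 := by simpa using hw
        have hW' : a (List.replicate w.length false).length = 1 := by simpa using hw
        rw [h.pair_add hw hW hW',
          h.pair_eq_zero (by simp) hw hs (singleton_suffix_replicate hw0 true), zero_add]
        have hm : ∀ s : Bool, ∀ j : ℕ,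
            mask [] (fun _ => 1) (List.replicate j s) = List.replicate j (!s) := by
          intro s j
          induction j with
          | zero => exact Omega.map_nil _
          | succ j ih =>
            rw [List.replicate_succ, Omega.map_cons_swap, ih, swap_mask]
            simp [List.replicate_succ]
        -- The mask exchanging all letters lies in `M a` because `a_0 = 0`, and it conjugates the
        -- pair in one half to the pair in the other.
        have hc : χ (flip (List.replicate w.length true) * flip V) =
            χ (flip (List.replicate w.length false) * flip U) := by
          refine h.map_eq_of_conj (mask_nil_mem_M ha0 fun _ => 1) (pair_mem_M hW hV)
            (pair_mem_M hW' hU) ?_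
          rw [← mul_assoc, mask_mul_flip _ (Nat.zero_le _), mul_assoc,
            mask_mul_flip _ (Nat.zero_le _), hm, hm, mul_assoc]
          rfl
        rw [h.pair_add hW hV hW', hc, h.pair_add hV hU hW', h.pair_comm hU hW', add_comm,
          add_assoc, CharTwo.add_self_eq_zero, add_zero]
      · have hs' : [false] <:+ w := (suffix_singleton_iff false w hwne).2 hs
        exact h.pair_eq_zero (by simp) hw hs' (singleton_suffix_replicate hw0 false)
    rw [key]
    exact CharTwo.add_self_eq_zero _

/-- The characters of `M a` for `a 0 = 1` and `a ≠ e_0`. -/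
theorem exists_eq_of_one (h : LevelChar a n χ) (ha : a ≠ Finsupp.single 0 1) (ha0 : a 0 = 1) :
    ∃ b : ℕ →₀ ZMod 2, ∀ σ ∈ M a, χ σ = phiSum b σ := by
  obtain ⟨k, hk⟩ := Finsupp.ne_iff.1 ha
  have hk0 : k ≠ 0 := by rintro rfl; simp [ha0] at hk
  rw [Finsupp.single_eq_of_ne hk0] at hk
  have hak : a k = 1 := zmod_two_eq_one.1 hk
  let U : Word := List.replicate k false
  have hU : a U.length = 1 := by simpa [U] using hak
  obtain ⟨b, hbn, hb⟩ := exists_finsupp n fun j =>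
    if a j = 0 then χ (flip (List.replicate j false))
    else χ (flip (List.replicate j false) * flip U)
  refine ⟨b, fun σ hσ => ?_⟩
  rw [← CharTwo.add_eq_zero]
  refine (h.add (levelChar_phiSum h.bound hbn)).eq_zero (w₀ := U) hU ?_ ?_ σ hσ
  · intro w hwn hw
    rw [phiSum_flip, hb _ hwn, hw, if_pos rfl,
      h.map_flip_eq hk0 hak (w' := List.replicate w.length false) (by simp) hw]
    exact CharTwo.add_self_eq_zero _
  · intro w hw
    have hwn : w.length < n := h.bound _ (by simp [hw])
    have hbU : b U.length = 0 := by
      rw [hb _ (h.bound _ (by simp [hU])), hU, if_neg one_ne_zero]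
      simp only [U, List.length_replicate]
      rw [flip_mul_flip, h.map_one]
    rw [phiSum_mul, phiSum_flip, phiSum_flip, hbU, add_zero, hb _ hwn, hw, if_neg one_ne_zero,
      CharTwo.add_eq_zero]
    rcases eq_or_ne w [] with rfl | hwne
    · rfl
    have hw0 : w.length ≠ 0 := by simpa using hwne
    rw [h.pair_add_coeff hak hw]
    convert add_zero _
    have hW : a (List.replicate w.length false).length = 1 := by simpa using hw
    have hfs := singleton_suffix_replicate hw0 false
    by_cases hs : [false] <:+ w
    · exact h.pair_eq_zero (by simp) hw hs hfs
    · have hs' : [true] <:+ w := by simpa using (suffix_singleton_iff false w hwne).not_left.1 hs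
      have hnil : a ([] : Word).length = 1 := ha0
      have hr : a (flip [] w).length = 1 := by rwa [Omega.length_map]
      have hrs : [false] <:+ flip [] w := by
        have h1 := (flip []).suffix_map hs'
        rwa [Omega.map_cons_swap, swap_flip, Omega.map_nil] at h1
      -- With `a_0 = 1` the root flip may be paired with `flip w`. The square of that pair is a pair
      -- across the halves, so every character kills it; this is why no `psi` appears here.
      have hsq : flip [] * flip w * (flip [] * flip w) = flip (flip [] w) * flip w :=
        (congrArg (· * (flip [] * flip w)) (flip_mul_flip_comm (Nat.zero_le _))).trans
          (flip_mul_cancel _ _ _)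
      have h1 : χ (flip (flip [] w) * flip w) = 0 := by
        rw [← hsq, h.map_mul _ (pair_mem_M hnil hw) _ (pair_mem_M hnil hw)]
        exact CharTwo.add_self_eq_zero _
      rw [h.pair_add hw hr hW, h.pair_comm hw hr, h1, zero_add]
      exact h.pair_eq_zero (by simp [Omega.length_map]) hr hrs hfs

/-- The characters of `M a` for `a = e_0`. -/
theorem exists_eq_of_single (h : LevelChar (Finsupp.single 0 1) n χ) :
    ∃ b : ℕ × Bool →₀ ZMod 2, ∀ σ ∈ M (Finsupp.single 0 1),
      χ σ = b.sum fun p e => e * phiAt [p.2] (p.1 + 1) σ := by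
  -- The index `(j, s)` stands for the words of length `j + 1` ending in `s`; level 0 is excluded
  -- because `φ_0` vanishes on the group.
  let c : ℕ × Bool → ZMod 2 := fun p =>
    if p.1 + 1 < n then χ (flip (List.replicate (p.1 + 1) p.2)) else 0
  let b : ℕ × Bool →₀ ZMod 2 := Finsupp.onFinset (Finset.range n ×ˢ Finset.univ) c (by
    intro p hp
    by_contra h'
    simp at h'
    apply hp
    simp only [c]
    rw [if_neg (by omega)])
  have hbn : ∀ p ∈ b.support, p.1 + 1 < n := by
    intro p hp
    by_contra h'
    exact Finsupp.mem_support_iff.1 hp (if_neg h')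
  refine ⟨b, fun σ hσ => ?_⟩
  rw [← CharTwo.add_eq_zero]
  have hb : LevelChar (Finsupp.single 0 1) n
      fun σ => b.sum fun p e => e * phiAt [p.2] (p.1 + 1) σ :=
    { bound := h.bound
      map_mul := fun σ _ τ hτ => by
        rw [mem_M, phiSum_single, phi_zero_of_map_singleton] at hτ
        simp only [phiAt_mul, mul_add, Finsupp.sum_add, hτ]
      congr := fun σ _ τ _ h => Finset.sum_congr rfl fun p hp => by
        simp only [phiAt_congr (hbn p hp) [p.2] h] }
  -- The empty word is the only one with coefficient 1, so the only product of two flips to test is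
  -- the trivial one.
  refine (h.add hb).eq_zero (w₀ := []) (by simp) ?_ ?_ σ hσ
  · intro w hwn hw
    have hw0 : w.length ≠ 0 := by intro h0; simp [h0] at hw
    obtain ⟨j, hj⟩ := Nat.exists_eq_succ_of_ne_zero hw0
    have hwne : w ≠ [] := by rintro rfl; exact hw0 rfl
    obtain ⟨s, hs⟩ := exists_suffix_singleton w hwne
    have hst : ∀ t, [t] <:+ w ↔ t = s := by
      intro t
      constructor
      · intro ht
        by_contra hne
        have : t = !s := by cases t <;> cases s <;> simp_all
        exact (suffix_singleton_iff s w hwne).1 hs (this ▸ ht)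
      · rintro rfl; exact hs
    have hsum : (b.sum fun p e => e * phiAt [p.2] (p.1 + 1) (flip w)) = b (j, s) := by
      have : ∀ p : ℕ × Bool, phiAt [p.2] (p.1 + 1) (flip w) = if p = (j, s) then 1 else 0 := by
        intro p
        rw [phiAt_flip]
        refine if_congr ?_ rfl rfl
        rw [hst, hj, Prod.ext_iff]
        constructor
        · rintro ⟨h1, h2⟩; exact ⟨by simp; omega, h2⟩
        · rintro ⟨h1, h2⟩; exact ⟨by simp at h1; omega, h2⟩
      simp only [this, mul_ite, mul_one, mul_zero]
      rw [Finsupp.sum_ite_eq']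
      split
      · rfl
      · exact (Finsupp.notMem_support_iff.1 ‹_›).symm
    have hbj : b (j, s) = χ (flip (List.replicate w.length s)) := by
      change (if j + 1 < n then _ else 0) = _
      rw [if_pos (by omega), hj]
    rw [hsum, hbj, CharTwo.add_eq_zero]
    -- Flips of one level in one half are conjugate by a mask over `[s]`, which fixes level 1 and so
    -- lies in the group.
    obtain ⟨m, hm⟩ := exists_mask [s] (w := w) (w' := List.replicate w.length s) (by simp) hs
      (singleton_suffix_replicate hw0 s)
    have hmask : mask [s] m ∈ M (Finsupp.single 0 1) := by
      rw [mem_M, phiSum_single, phi_zero_eq, swap_mask, if_neg]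
      intro h; simpa using h.length_le
    refine h.map_eq_of_conj hmask (flip_mem_M.2 hw) (flip_mem_M.2 (by simpa using hw)) ?_
    rw [mask_mul_flip m hs.length_le, hm]
  · intro w hw
    have hw0 : w = [] := by
      by_contra hne
      rw [Finsupp.single_eq_of_ne (by simpa using hne)] at hw
      exact zero_ne_one hw
    rw [hw0, flip_mul_flip]
    exact (h.add hb).map_one

end LevelChar

/-! ## Subgroups of the subgroups `M a` that no character detects -/

/-- The action on the words of length `n`. -/
def levelHom (n : ℕ) : Omega →* Equiv.Perm (List.Vector Bool n) where
  toFun σ := levelPerm σ n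
  map_one' := Equiv.ext fun _ => rfl
  map_mul' _ _ := Equiv.ext fun _ => rfl

theorem levelHom_eq_iff {n : ℕ} {σ τ : Omega} :
    levelHom n σ = levelHom n τ ↔ ∀ w : Word, w.length ≤ n → σ w = τ w := by
  constructor
  · intro h w hw
    let w' : Word := List.replicate (n - w.length) false ++ w
    have hw' : w'.length = n := by simp [w']; omega
    have e : σ w' = τ w' := congrArg Subtype.val (Equiv.congr_fun h ⟨w', hw'⟩)
    have h1 : σ w <:+ σ w' := σ.suffix_map (List.suffix_append _ _)
    have h2 : τ w <:+ σ w' := e ▸ τ.suffix_map (List.suffix_append _ _)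
    exact (List.suffix_of_suffix_length_le h1 h2 (by simp [Omega.length_map])).eq_of_length
      (by simp [Omega.length_map])
  · intro h
    exact Equiv.ext fun w => Subtype.ext (h w.1 w.2.le)

/-- Inductively, `σ ^ 2 ^ n` fixes the words of length at most `n`, so squaring it doubles the
digits there. This makes the action on each level that of a 2-group. -/
theorem exists_pow_levelHom (n : ℕ) (σ : Omega) :
    ∀ w : Word, w.length < n → swap (σ ^ 2 ^ n) w = 0 := by
  induction n with
  | zero => intro w hw; omega
  | succ n ih =>
    intro w hw
    have h := Omega.map_eq_of_swap_eq (σ := σ ^ 2 ^ n) (τ := 1) (n := n)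
      (fun v hv => by rw [ih v hv, swap_one]) w (by omega)
    rw [pow_succ, pow_mul, pow_two, swap_mul, h]
    exact CharTwo.add_self_eq_zero _

/-- A proper subgroup of a finite 2-group extends, by Sylow's theorem, to a subgroup of order half
that of the group. -/
theorem exists_index_two {G : Type*} [Group G] [Finite G] (hG : IsPGroup 2 G) {H : Subgroup G}
    (hH : H ≠ ⊤) : ∃ L : Subgroup G, L.index = 2 ∧ H ≤ L := by
  have : Fact (Nat.Prime 2) := ⟨Nat.prime_two⟩
  obtain ⟨m, hm⟩ := IsPGroup.iff_card.1 hG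
  obtain ⟨k, hk⟩ := IsPGroup.iff_card.1 (hG.to_subgroup H)
  have hlt : Nat.card H < Nat.card G := by
    refine lt_of_le_of_ne (Subgroup.card_le_card_group H) fun h => hH ?_
    exact Subgroup.eq_top_of_card_eq H h
  rw [hm, hk, Nat.pow_lt_pow_iff_right (by norm_num)] at hlt
  obtain ⟨j, rfl⟩ : ∃ j, m = j + 1 := ⟨m - 1, by omega⟩
  obtain ⟨L, hL, hle⟩ := Sylow.exists_subgroup_card_pow_prime_le 2 (n := k) (m := j)
    (by rw [hm]; exact pow_dvd_pow 2 (Nat.le_succ j)) H hk (by omega)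
  refine ⟨L, ?_, hle⟩
  have := L.card_mul_index
  rw [hL, hm, pow_succ] at this
  exact Nat.eq_of_mul_eq_mul_left (by positivity) this

/-- A subgroup of `M a` on which no nonzero character of level `n` vanishes is dense in `M a` up to
level `n`. -/
theorem exists_agree_of_levelChar {a : ℕ →₀ ZMod 2} {n : ℕ} (ha : ∀ i, a i ≠ 0 → i < n)
    {H : Subgroup Omega} (hH : H ≤ M a)
    (hχ : ∀ χ, LevelChar a n χ → (∀ σ ∈ H, χ σ = 0) → ∀ σ ∈ M a, χ σ = 0)
    {σ : Omega} (hσ : σ ∈ M a) : ∃ η ∈ H, ∀ w : Word, w.length ≤ n → η w = σ w := by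
  suffices h : (M a).map (levelHom n) ≤ H.map (levelHom n) by
    obtain ⟨η, hη, e⟩ := h ⟨σ, hσ, rfl⟩
    exact ⟨η, hη, levelHom_eq_iff.1 e⟩
  by_contra hne
  set P := (M a).map (levelHom n)
  set Q := H.map (levelHom n)
  have hP : IsPGroup 2 P := by
    rintro ⟨_, σ, hσ, rfl⟩
    refine ⟨n, Subtype.ext ?_⟩
    change levelHom n σ ^ 2 ^ n = 1
    rw [← map_pow, ← map_one (levelHom n)]
    refine levelHom_eq_iff.2 (Omega.map_eq_of_swap_eq fun w hw => ?_)
    rw [exists_pow_levelHom n σ w hw, swap_one]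
  obtain ⟨L, hL, hle⟩ := exists_index_two hP (H := Q.subgroupOf P)
    (fun h => hne (Subgroup.subgroupOf_eq_top.1 h))
  classical
  -- The character of `M a` whose kernel is the preimage of `L`; it vanishes on `H`, and if it
  -- vanished on `M a` then `L` would be the whole group.
  let χ : Omega → ZMod 2 := fun σ => if levelHom n σ ∈ L.map P.subtype then 0 else 1
  have hmem : ∀ σ, ∀ h : σ ∈ M a,
      (levelHom n σ ∈ L.map P.subtype ↔ (⟨levelHom n σ, σ, h, rfl⟩ : P) ∈ L) := by
    intro σ h
    constructor
    · rintro ⟨x, hx, e⟩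
      have : x = ⟨levelHom n σ, σ, h, rfl⟩ := Subtype.ext e
      exact this ▸ hx
    · intro h'
      exact ⟨_, h', rfl⟩
  have hlc : LevelChar a n χ :=
    { bound := ha
      map_mul := by
        intro σ hσ τ hτ
        have key : levelHom n (σ * τ) ∈ L.map P.subtype ↔
            (levelHom n σ ∈ L.map P.subtype ↔ levelHom n τ ∈ L.map P.subtype) := by
          rw [hmem σ hσ, hmem τ hτ, hmem _ (mul_mem hσ hτ), ← Subgroup.mul_mem_iff_of_index_two hL]
          rfl
        simp only [χ, key]
        by_cases h1 : levelHom n σ ∈ L.map P.subtype <;>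
          by_cases h2 : levelHom n τ ∈ L.map P.subtype <;> simp [h1, h2]
        decide
      congr := by
        intro σ _ τ _ h
        simp only [χ]
        rw [levelHom_eq_iff.2 (Omega.map_eq_of_swap_eq h)] }
  have hzero := hχ χ hlc fun σ hσ => if_pos ((hmem σ (hH hσ)).2 (hle
    (Subgroup.mem_subgroupOf.2 ⟨σ, hσ, rfl⟩)))
  have htop : L = ⊤ := by
    rw [eq_top_iff]
    rintro ⟨_, σ, hσ, rfl⟩ _
    rw [← hmem σ hσ]
    by_contra hn
    have := hzero σ hσ
    simp only [χ, if_neg hn] at this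
    exact one_ne_zero this
  rw [htop, Subgroup.index_top] at hL
  omega

/-! ## Kummer characters -/

section Kummer

variable {F : Type u} [Field F] {K : Type v} [Field K] [Algebra F K]

/-- The character of the field with two elements with values `1` and `-1`. -/
def sgn (K : Type v) [Field K] (e : ZMod 2) : K := if e = 0 then 1 else -1

theorem sgn_zero : sgn K 0 = 1 := if_pos rfl

theorem sgn_one : sgn K 1 = -1 := if_neg one_ne_zero

theorem sgn_add (d e : ZMod 2) : sgn K (d + e) = sgn K d * sgn K e := by
  rcases zmod_two_cases d with rfl | rfl <;> rcases zmod_two_cases e with rfl | rfl <;>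
    simp [CharTwo.add_self_eq_zero, sgn_zero, sgn_one]

theorem sgn_sum {I : Type*} (s : Finset I) (e : I → ZMod 2) :
    sgn K (∑ i ∈ s, e i) = ∏ i ∈ s, sgn K (e i) := by
  classical
  induction s using Finset.induction_on with
  | empty => simp [sgn_zero]
  | insert i s hi ih => rw [Finset.sum_insert hi, Finset.prod_insert hi, sgn_add, ih]

theorem sgn_mul (d e : ZMod 2) : sgn K (d * e) = sgn K e ^ d.val := by
  rcases zmod_two_cases d with rfl | rfl
  · simp [sgn_zero]
  · simp [ZMod.val_one]

theorem sgn_sq (e : ZMod 2) : sgn K e ^ 2 = 1 := by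
  rcases zmod_two_cases e with rfl | rfl <;> simp [sgn_zero, sgn_one]

theorem map_sgn (g : K ≃ₐ[F] K) (e : ZMod 2) : g (sgn K e) = sgn K e := by
  rcases zmod_two_cases e with rfl | rfl <;> simp [sgn_zero, sgn_one]

theorem sgn_eq_one (h2 : (2 : K) ≠ 0) {e : ZMod 2} : sgn K e = 1 ↔ e = 0 := by
  rcases zmod_two_cases e with rfl | rfl
  · simp [sgn_zero]
  · simp only [sgn_one, one_ne_zero, iff_false]
    intro h
    apply h2
    linear_combination -h

/-- The element `z` has a square root in `K` on which the Galois group acts through the signs given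
by `χ`. -/
def IsKummer (z : F) (χ : (K ≃ₐ[F] K) → ZMod 2) : Prop :=
  ∃ y : K, y ≠ 0 ∧ y ^ 2 = algebraMap F K z ∧ ∀ g : K ≃ₐ[F] K, g y = sgn K (χ g) * y

namespace IsKummer

variable {z z' : F} {χ χ' : (K ≃ₐ[F] K) → ZMod 2}

theorem ne_zero (h : IsKummer z χ) : z ≠ 0 := by
  obtain ⟨y, hy, e, -⟩ := h
  rintro rfl
  rw [map_zero] at e
  exact hy (pow_eq_zero_iff two_ne_zero |>.1 e)

theorem mul (h : IsKummer z χ) (h' : IsKummer z' χ') :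
    IsKummer (z * z') fun g => χ g + χ' g := by
  obtain ⟨y, hy, e, hg⟩ := h
  obtain ⟨y', hy', e', hg'⟩ := h'
  refine ⟨y * y', mul_ne_zero hy hy', by rw [mul_pow, e, e', map_mul], fun g => ?_⟩
  rw [map_mul, hg, hg', sgn_add]
  ring

theorem prod {I : Type*} {x : I → F} {χ : I → (K ≃ₐ[F] K) → ZMod 2} (b : I →₀ ZMod 2)
    (h : ∀ i, IsKummer (x i) (χ i)) :
    IsKummer (b.prod fun i e => x i ^ e.val) fun g => b.sum fun i e => e * χ i g := by
  choose y hy e hg using h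
  refine ⟨b.prod fun i e => y i ^ e.val, ?_, ?_, fun g => ?_⟩
  · exact Finset.prod_ne_zero_iff.2 fun i _ => pow_ne_zero _ (hy i)
  · simp only [Finsupp.prod, map_prod, ← Finset.prod_pow, map_pow, ← e]
    exact Finset.prod_congr rfl fun i _ => by rw [← pow_mul, ← pow_mul, mul_comm]
  · simp only [Finsupp.prod, Finsupp.sum, map_prod, map_pow, sgn_sum, sgn_mul, hg, mul_pow,
      Finset.prod_mul_distrib]

/-- Square roots are unique up to sign, so `z` is a square in `F` exactly when `y` is fixed by
Galois; in characteristic other than 2 this means that all signs are trivial. -/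
theorem isUnitSq_iff [IsGalois F K] (h2 : (2 : K) ≠ 0) (h : IsKummer z χ) :
    IsUnitSq z ↔ ∀ g, χ g = 0 := by
  obtain ⟨y, hy, e, hg⟩ := h
  constructor
  · rintro ⟨w, rfl⟩ g
    rw [map_pow, sq_eq_sq_iff_eq_or_eq_neg] at e
    have hfix : g y = y := by
      rcases e with rfl | rfl
      · exact g.commutes _
      · rw [map_neg, g.commutes]
    rw [hg] at hfix
    exact (sgn_eq_one h2).1 (mul_right_cancel₀ hy (hfix.trans (one_mul y).symm))
  · intro h
    have hfix : ∀ g : K ≃ₐ[F] K, g y = y := fun g => by rw [hg, h, sgn_zero, one_mul]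
    obtain ⟨w, rfl⟩ := (InfiniteGalois.mem_range_algebraMap_iff_fixed y).2 hfix
    have hw : w ≠ 0 := by rintro rfl; exact hy (map_zero _)
    refine ⟨Units.mk0 w hw, ?_⟩
    rw [← map_pow] at e
    exact ((algebraMap F K).injective e).symm

end IsKummer

end Kummer

/-! ## Iterates -/

section Labeling

variable {F : Type u} [Field F] {K : Type v} [Field K] [Algebra F K]

theorem iter_succ (f : F[X]) (n : ℕ) : iter f (n + 1) = f.comp (iter f n) :=
  Function.iterate_succ_apply' _ _ _

theorem iter_succ' (f : F[X]) (n : ℕ) : iter f (n + 1) = (iter f n).comp f := by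
  induction n with
  | zero => rw [iter_succ]; simp [iter]
  | succ n ih => rw [iter_succ, ih, ← comp_assoc, ← iter_succ, ih]

theorem iter_succ_eval (f : F[X]) (n : ℕ) (z : F) :
    (iter f (n + 1)).eval z = (iter f n).eval (f.eval z) := by
  rw [iter_succ', eval_comp]

theorem quad_aeval (γ δ : F) (z : K) :
    aeval z (quad γ δ) = (z - algebraMap F K γ) ^ 2 - algebraMap F K δ := by
  simp [quad]

theorem quad_eval (γ δ z : F) : (quad γ δ).eval z = (z - γ) ^ 2 - δ := by simp [quad]

theorem orbit_zero (γ δ : F) : orbit γ δ 0 = δ := by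
  rw [orbit, quad_eval]; ring

theorem quad_monic (γ δ : F) : (quad γ δ).Monic :=
  ((monic_X_sub_C γ).pow 2).sub_of_left (by
    rw [degree_pow, degree_X_sub_C]
    exact degree_C_le.trans_lt (by norm_num))

theorem quad_natDegree (γ δ : F) : (quad γ δ).natDegree = 2 := by
  rw [quad, natDegree_sub_C, natDegree_pow, natDegree_X_sub_C]

theorem iter_monic (γ δ : F) (n : ℕ) : (iter (quad γ δ) n).Monic := by
  induction n with
  | zero => exact monic_X
  | succ n ih =>
    rw [iter_succ']
    exact ih.comp (quad_monic γ δ) (by rw [quad_natDegree]; norm_num)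

theorem iter_natDegree (γ δ : F) (n : ℕ) : (iter (quad γ δ) n).natDegree = 2 ^ n := by
  induction n with
  | zero => exact natDegree_X
  | succ n ih => rw [iter_succ', natDegree_comp, ih, quad_natDegree, pow_succ]

theorem Node.aeval_val {f : F[X]} (p : Node f K) : aeval p.val (iter f p.level) = 0 := p.2.2

theorem Node.ext {f : F[X]} {p q : Node f K} (h : p.level = q.level) (h' : p.val = q.val) :
    p = q := by
  obtain ⟨n, α, hα⟩ := p
  obtain ⟨m, β, hβ⟩ := q
  change n = m at h
  change α = β at h'
  subst h h'
  rfl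

/-- A node of positive level has a parent. -/
theorem Node.exists_parent {f : F[X]} (p : Node f K) {n : ℕ} (h : p.level = n + 1) :
    ∃ q : Node f K, NodeEdge f K q p := by
  refine ⟨⟨n, aeval p.val f, ?_⟩, h, rfl⟩
  have := p.aeval_val
  rwa [h, iter_succ', aeval_comp] at this

/-! ## Labeled trees -/

namespace Labeling

variable {γ δ : F} (ι : Labeling (quad γ δ) K)

/-- The root of an iterate of `f` with a given label. -/
noncomputable def root (w : Word) : K := (ι.symm w).val

theorem edge (s : Bool) (w : Word) : NodeEdge (quad γ δ) K (ι.symm w) (ι.symm (s :: w)) :=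
  ι.symm.map_rel_iff.2 ⟨s, rfl⟩

theorem level_symm (w : Word) : (ι.symm w).level = w.length := by
  induction w with
  | nil =>
    cases h : (ι.symm []).level with
    | zero => rfl
    | succ n =>
      obtain ⟨q, hq⟩ := (ι.symm []).exists_parent h
      obtain ⟨s, hs⟩ := ι.map_rel_iff.2 hq
      simp at hs
  | cons s w ih => rw [(ι.edge s w).1, ih, List.length_cons]

theorem root_nil : ι.root [] = 0 := by
  have h := (ι.symm []).aeval_val
  rw [ι.level_symm] at h
  simpa [iter, root] using h

theorem root_cons (s : Bool) (w : Word) :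
    (ι.root (s :: w) - algebraMap F K γ) ^ 2 = ι.root w + algebraMap F K δ := by
  have h : aeval (ι.root (s :: w)) (quad γ δ) = ι.root w := (ι.edge s w).2
  rw [quad_aeval] at h
  linear_combination h

theorem root_injective {v w : Word} (hl : v.length = w.length) (h : ι.root v = ι.root w) :
    v = w :=
  ι.symm.injective (Node.ext (by rw [level_symm, level_symm, hl]) h)

/-- The square root `β_{x w} - γ` of `β_w + δ`. -/
noncomputable def rad (w : Word) : K := ι.root (false :: w) - algebraMap F K γ

theorem root_false (w : Word) : ι.root (false :: w) = algebraMap F K γ + ι.rad w := by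
  rw [rad]; ring

theorem root_true (w : Word) : ι.root (true :: w) = algebraMap F K γ - ι.rad w := by
  have h := (ι.root_cons true w).trans (ι.root_cons false w).symm
  rw [sq_eq_sq_iff_eq_or_eq_neg] at h
  rcases h with h | h
  · have := ι.root_injective (v := true :: w) (w := false :: w) rfl (sub_left_injective h)
    simp at this
  · rw [rad]; linear_combination h

theorem rad_sq (w : Word) : ι.rad w ^ 2 = ι.root w + algebraMap F K δ := ι.root_cons false w

theorem rad_ne_zero (w : Word) : ι.rad w ≠ 0 := by
  intro h
  have := ι.root_injective (v := true :: w) (w := false :: w) rfl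
    (by rw [root_true, root_false, h]; ring)
  simp at this

/-- The automorphism of the standard tree through which a Galois automorphism acts. -/
noncomputable def galAct : (K ≃ₐ[F] K) →* Omega :=
  ι.conj.toMonoidHom.comp (arborealRep (quad γ δ) K)

theorem mem_imRho {σ : Omega} : σ ∈ imRho ι ↔ ∃ g, ι.galAct g = σ := MonoidHom.mem_range

theorem root_galAct (g : K ≃ₐ[F] K) (w : Word) : ι.root (ι.galAct g w) = g (ι.root w) := by
  have h : ι.galAct g w = ι (galNode g (ι.symm w)) := rfl
  rw [root, h, RelIso.symm_apply_apply]
  rfl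

/-- The bridge between field and tree: the digits of the portrait are the signs with which Galois
acts on the chosen radicals. -/
theorem map_rad (g : K ≃ₐ[F] K) (w : Word) :
    g (ι.rad w) = sgn K (swap (ι.galAct g) w) * ι.rad (ι.galAct g w) := by
  have h : g (ι.rad w) = ι.root (ι.galAct g (false :: w)) - algebraMap F K γ := by
    rw [root_galAct, rad, map_sub, g.commutes]
  rw [h, Omega.map_cons_swap]
  rcases zmod_two_cases (swap (ι.galAct g) w) with e | e
  · rw [e, sgn_zero]
    simp [root_false]
  · rw [e, sgn_one]
    simp [root_true]

/-- The product of the `rad w` over the words `w` of length `i` above `v`. -/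
noncomputable def radProd (v : Word) (i : ℕ) : K :=
  ∏ w : List.Vector Bool i, if v <:+ w.toList then ι.rad w.toList else 1

theorem radProd_ne_zero (v : Word) (i : ℕ) : ι.radProd v i ≠ 0 := by
  refine Finset.prod_ne_zero_iff.2 fun w _ => ?_
  split
  · exact ι.rad_ne_zero _
  · exact one_ne_zero

theorem map_radProd (g : K ≃ₐ[F] K) (v : Word) (i : ℕ) :
    g (ι.radProd v i) = sgn K (phiAt v i (ι.galAct g)) * ι.radProd (ι.galAct g v) i := by
  unfold radProd phiAt
  rw [map_prod, sgn_sum, ← Equiv.prod_comp (levelPerm (ι.galAct g) i)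
    (fun w => if ι.galAct g v <:+ w.toList then ι.rad w.toList else 1), ← Finset.prod_mul_distrib]
  refine Finset.prod_congr rfl fun w _ => ?_
  change _ = _ * if ι.galAct g v <:+ ι.galAct g w.toList then ι.rad (ι.galAct g w.toList) else 1
  simp only [Omega.suffix_map_iff]
  split
  · exact ι.map_rad g _
  · simp [sgn_zero]

theorem prod_vector_succ {A : Type*} [CommMonoid A] (i : ℕ) (h : Word → A) :
    ∏ w : List.Vector Bool (i + 1), h w.toList =
      ∏ w : List.Vector Bool i, h (false :: w.toList) * h (true :: w.toList) := by
  let e : Bool × List.Vector Bool i ≃ List.Vector Bool (i + 1) :=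
    { toFun := fun p => p.1 ::ᵥ p.2
      invFun := fun w => (w.head, w.tail)
      left_inv := fun p => by simp
      right_inv := fun w => by simp }
  rw [← Equiv.prod_comp e, Fintype.prod_prod_type_right]
  refine Finset.prod_congr rfl fun w _ => ?_
  rw [Fintype.prod_bool, mul_comm]
  simp [e]

theorem prod_vector_length {A : Type*} [CommMonoid A] (v : Word) (h : Word → A) :
    ∏ w : List.Vector Bool v.length, (if v <:+ w.toList then h w.toList else 1) = h v := by
  let v' : List.Vector Bool v.length := ⟨v, rfl⟩
  refine (Finset.prod_eq_single v' ?_ ?_).trans ?_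
  · intro u _ hu
    refine if_neg fun hs => hu ?_
    exact Subtype.ext (hs.eq_of_length u.2.symm).symm
  · intro h; exact absurd (Finset.mem_univ _) h
  · exact if_pos (List.suffix_refl v)

theorem prod_vector_succ_suffix {A : Type*} [CommMonoid A] (v : Word) {i : ℕ} (hi : v.length ≤ i)
    (h : Word → A) :
    ∏ w : List.Vector Bool (i + 1), (if v <:+ w.toList then h w.toList else 1) =
      ∏ w : List.Vector Bool i,
        if v <:+ w.toList then h (false :: w.toList) * h (true :: w.toList) else 1 := by
  rw [prod_vector_succ i fun u => if v <:+ u then h u else 1]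
  refine Finset.prod_congr rfl fun w _ => ?_
  have key : ∀ s : Bool, v <:+ s :: w.toList ↔ v <:+ w.toList := by
    intro s
    rw [List.suffix_cons_iff]
    refine or_iff_right fun h => ?_
    have := congrArg List.length h
    rw [List.length_cons, List.Vector.toList_length] at this
    omega
  simp only [key]
  split
  · rfl
  · exact mul_one _

theorem mul_sub_root (z : F) (w : Word) :
    (algebraMap F K z - ι.root (false :: w)) * (algebraMap F K z - ι.root (true :: w)) =
      algebraMap F K ((quad γ δ).eval z) - ι.root w := by
  rw [root_false, root_true, quad_eval, map_sub, map_pow, map_sub]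
  linear_combination - ι.rad_sq w

/-- Multiplying the factors of two siblings replaces `z` by `f(z)` and the siblings by their parent.
Iterating `j` times descends to `v`. -/
theorem prod_sub_root (v : Word) (j : ℕ) (z : F) :
    ∏ w : List.Vector Bool (v.length + j),
        (if v <:+ w.toList then algebraMap F K z - ι.root w.toList else 1) =
      algebraMap F K ((iter (quad γ δ) j).eval z) - ι.root v := by
  induction j generalizing z with
  | zero =>
    refine (prod_vector_length v fun w => algebraMap F K z - ι.root w).trans ?_
    simp [iter]
  | succ j ih =>
    refine (prod_vector_succ_suffix v (i := v.length + j) (by omega)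
      fun w => algebraMap F K z - ι.root w).trans ?_
    simp only [mul_sub_root]
    rw [ih, iter_succ_eval]

theorem radProd_sq (v : Word) (i : ℕ) : ι.radProd v i ^ 2 =
    ∏ w : List.Vector Bool i,
      if v <:+ w.toList then ι.root w.toList + algebraMap F K δ else 1 := by
  rw [radProd, ← Finset.prod_pow]
  refine Finset.prod_congr rfl fun w _ => ?_
  split
  · exact ι.rad_sq _
  · exact one_pow 2

theorem radProd_length_sq (v : Word) :
    ι.radProd v v.length ^ 2 = ι.root v + algebraMap F K δ := by
  rw [radProd_sq]
  exact prod_vector_length v fun w => ι.root w + algebraMap F K δ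

/-- Each factor is `β_w + δ = -(f(γ) - β_w)`. At a level strictly above `v` the factors come in
sibling pairs, so the signs cancel. For `v` alone the sign survives, which explains the sign in `c_0
= -f(γ)`. -/
theorem radProd_add_sq (v : Word) (j : ℕ) :
    ι.radProd v (v.length + j + 1) ^ 2 =
      algebraMap F K ((iter (quad γ δ) (j + 2)).eval γ) - ι.root v := by
  rw [radProd_sq]
  refine (prod_vector_succ_suffix v (i := v.length + j) (by omega)
      fun w => ι.root w + algebraMap F K δ).trans ?_
  have hγ : (quad γ δ).eval γ = -δ := by rw [quad_eval]; ring
  rw [iter_succ_eval, iter_succ_eval, hγ, ← prod_sub_root]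
  refine Finset.prod_congr rfl fun w _ => ?_
  rw [← mul_sub_root, map_neg]
  split
  · ring
  · rfl

theorem radProd_nil_sq (i : ℕ) : ι.radProd [] i ^ 2 = algebraMap F K (orbit γ δ i) := by
  cases i with
  | zero =>
    rw [orbit_zero]
    refine (ι.radProd_length_sq []).trans ?_
    rw [root_nil, zero_add]
  | succ i =>
    have := ι.radProd_add_sq [] i
    rw [root_nil, sub_zero] at this
    rw [orbit, ← this]
    simp

theorem radProd_singleton_sq (s : Bool) (i : ℕ) :
    ι.radProd [s] (i + 1) ^ 2 = cTilde ι s (i + 1) := by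
  cases i with
  | zero =>
    refine (ι.radProd_length_sq [s]).trans ?_
    rw [cTilde, orbit_zero, add_comm, root]
  | succ i =>
    have := ι.radProd_add_sq [s] i
    rw [cTilde, orbit, ← root, ← this]
    congr 2
    simp; omega

theorem isKummer_orbit (i : ℕ) : IsKummer (orbit γ δ i) fun g => phi i (ι.galAct g) :=
  ⟨ι.radProd [] i, ι.radProd_ne_zero [] i, ι.radProd_nil_sq i, fun g => by
    rw [map_radProd, phiAt_nil, Omega.map_nil]⟩

theorem isKummer_orbitProd (b : ℕ →₀ ZMod 2) :
    IsKummer (orbitProd γ δ b) fun g => phiSum b (ι.galAct g) :=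
  IsKummer.prod b ι.isKummer_orbit

end Labeling

end Labeling

/-! ## Transitivity -/

/-- A mask moves `w` to `w'`. If it is outside `M a`, a flip at a level `k ≠ 0` of the support, in
the half not containing `w'`, corrects it without moving `w'`. -/
theorem exists_mem_M_map_eq {a : ℕ →₀ ZMod 2} (ha : a ≠ 0) (ha' : a ≠ Finsupp.single 0 1)
    {w w' : Word} (hl : w.length = w'.length) : ∃ σ ∈ M a, σ w = w' := by
  obtain ⟨k, hk0, hk⟩ : ∃ k, k ≠ 0 ∧ a k = 1 := by
    by_contra! hn
    have hz : ∀ k, k ≠ 0 → a k = 0 := fun k hk => by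
      by_contra h; exact hn k hk (zmod_two_eq_one.1 h)
    have hs : a = Finsupp.single 0 (a 0) := by
      ext k
      rcases eq_or_ne k 0 with rfl | h
      · simp
      · rw [hz k h, Finsupp.single_eq_of_ne h]
    rcases zmod_two_cases (a 0) with h | h
    · rw [h, Finsupp.single_zero] at hs; exact ha hs
    · rw [h] at hs; exact ha' hs
  rcases eq_or_ne w' [] with rfl | hne
  · exact ⟨1, one_mem _, List.length_eq_zero_iff.1 hl⟩
  obtain ⟨m, hm⟩ := exists_mask [] hl List.nil_suffix List.nil_suffix
  by_cases hσ : mask [] m ∈ M a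
  · exact ⟨_, hσ, hm⟩
  obtain ⟨s, hs⟩ := exists_suffix_singleton w' hne
  have hv := singleton_suffix_replicate hk0 (!s)
  refine ⟨flip (List.replicate k !s) * mask [] m, mul_mem_M_of_notMem ?_ hσ, ?_⟩
  · rw [flip_mem_M]; simp [hk]
  · rw [Omega.mul_apply, hm]
    exact flip_apply_of_not_suffix (not_suffix_of_singleton hv hs)

theorem mask_singleton_mem_M (s : Bool) (m : ℕ → ZMod 2) :
    mask [s] m ∈ M (Finsupp.single 0 1) := by
  rw [mem_M, phiSum_single, phi_zero_eq, swap_mask, if_neg]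
  intro h; simpa using h.length_le

section

variable {F : Type u} [Field F] {K : Type v} [Field K] [Algebra F K]

namespace Labeling

variable {γ δ : F} (ι : Labeling (quad γ δ) K)

theorem aeval_root_append (u v : Word) :
    aeval (ι.root (u ++ v)) (iter (quad γ δ) u.length) = ι.root v := by
  induction u with
  | nil => simp [iter]
  | cons s u ih =>
    have h : aeval (ι.root (s :: u ++ v)) (quad γ δ) = ι.root (u ++ v) :=
      (ι.edge s (u ++ v)).2
    rw [List.length_cons, iter_succ', aeval_comp, h, ih]

/-- A polynomial whose roots are permuted transitively by the Galois group is irreducible. -/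
theorem irreducible_of_transitive [IsGalois F K] (n : ℕ) (v : Word) {q : F[X]} (hq : q.Monic)
    (hdeg : q.natDegree = 2 ^ n)
    (hroot : ∀ u : Word, u.length = n → aeval (ι.root (u ++ v)) q = 0)
    (htrans : ∀ u u' : Word, u.length = n → u'.length = n →
      ∃ σ ∈ imRho ι, σ (u ++ v) = u' ++ v) : Irreducible q := by
  classical
  set u₀ : Word := List.replicate n false
  have hu₀ : u₀.length = n := by simp [u₀]
  set α := ι.root (u₀ ++ v)
  have hα : IsIntegral F α := Algebra.IsIntegral.isIntegral α
  have hconj : ∀ u : List.Vector Bool n, aeval (ι.root (u.toList ++ v)) (minpoly F α) = 0 := by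
    intro u
    obtain ⟨σ, hσ, e⟩ := htrans u₀ u.toList hu₀ u.2
    obtain ⟨g, rfl⟩ := ι.mem_imRho.1 hσ
    rw [← e, root_galAct]
    have := aeval_algHom_apply (g : K →ₐ[F] K) α (minpoly F α)
    rw [minpoly.aeval, map_zero] at this
    exact this
  have hinj : Function.Injective fun u : List.Vector Bool n => ι.root (u.toList ++ v) := by
    intro u u' h
    have := ι.root_injective (by simp) h
    exact Subtype.ext (List.append_cancel_right this)
  -- The conjugates of `α` are `2 ^ n` distinct roots of its minimal polynomial, which therefore has
  -- the full degree of `q`.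
  have hcard : 2 ^ n ≤ (minpoly F α).natDegree := by
    have h1 : (Finset.univ.image fun u : List.Vector Bool n => ι.root (u.toList ++ v)) ⊆
        ((minpoly F α).aroots K).toFinset := by
      intro x hx
      obtain ⟨u, -, rfl⟩ := Finset.mem_image.1 hx
      rw [Multiset.mem_toFinset, mem_aroots]
      exact ⟨minpoly.ne_zero hα, hconj u⟩
    have h2 := Finset.card_le_card h1
    rw [Finset.card_image_of_injective _ hinj, Finset.card_univ, card_vector,
      Fintype.card_bool] at h2
    refine h2.trans ((Multiset.toFinset_card_le _).trans ((card_roots' _).trans ?_))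
    rw [natDegree_map]
  have : q = minpoly F α := eq_of_monic_of_dvd_of_natDegree_le (minpoly.monic hα) hq
    (minpoly.dvd F α (hroot u₀ hu₀)) (hdeg.trans_le hcard)
  rw [this]
  exact minpoly.irreducible hα

/-! ## The image of the Galois group is closed -/

theorem isOpen_setOf_apply_eq [IsGalois F K] (α β : K) :
    IsOpen {g : K ≃ₐ[F] K | g α = β} := by
  by_cases h : ∃ g₀ : K ≃ₐ[F] K, g₀ α = β
  · obtain ⟨g₀, hg₀⟩ := h
    convert (stabilizer_isOpen_of_isIntegral (K := F) α).preimage (continuous_const_mul g₀⁻¹)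
    ext g
    change g α = β ↔ g₀.symm (g α) = α
    rw [AlgEquiv.symm_apply_eq, hg₀]
  · convert isOpen_empty
    ext g
    simp only [Set.mem_ofPred_eq, Set.mem_empty_iff_false, iff_false]
    exact fun hg => h ⟨g, hg⟩

theorem isClosed_setOf_apply_eq [IsGalois F K] (α β : K) :
    IsClosed {g : K ≃ₐ[F] K | g α = β} := by
  rw [← isOpen_compl_iff]
  convert isOpen_iUnion fun x : {x : K // x ≠ β} => isOpen_setOf_apply_eq (F := F) α x
  ext g
  simp

/-- The Galois elements acting as `σ` up to level `n` form a decreasing sequence of nonempty closed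
sets in a compact group; a common element acts as `σ`. -/
theorem mem_imRho_of_forall_agree [IsGalois F K] {σ : Omega}
    (h : ∀ n : ℕ, ∃ η ∈ imRho ι, ∀ w : Word, w.length ≤ n → η w = σ w) : σ ∈ imRho ι := by
  have hiff : ∀ (g : K ≃ₐ[F] K) (w : Word),
      ι.galAct g w = σ w ↔ g (ι.root w) = ι.root (σ w) := by
    intro g w
    rw [← root_galAct]
    exact ⟨fun h => by rw [h], ι.root_injective (by rw [Omega.length_map, Omega.length_map])⟩
  let C : ℕ → Set (K ≃ₐ[F] K) := fun n => {g | ∀ w : Word, w.length ≤ n → ι.galAct g w = σ w}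
  have hC : ∀ n, IsClosed (C n) := by
    intro n
    have : C n = ⋂ (w : Word) (_ : w.length ≤ n),
        {g : K ≃ₐ[F] K | g (ι.root w) = ι.root (σ w)} := by
      ext g
      simp [C, hiff]
    rw [this]
    exact isClosed_iInter fun w => isClosed_iInter fun _ => isClosed_setOf_apply_eq _ _
  obtain ⟨g, hg⟩ := IsCompact.nonempty_iInter_of_sequence_nonempty_isCompact_isClosed C
    (fun n g hg w hw => hg w (hw.trans n.le_succ))
    (fun n => by
      obtain ⟨η, hη, e⟩ := h n
      obtain ⟨g, rfl⟩ := ι.mem_imRho.1 hη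
      exact ⟨g, e⟩)
    (hC 0).isCompact hC
  rw [Set.mem_iInter] at hg
  exact ι.mem_imRho.2 ⟨g, RelIso.ext fun w => hg w.length w le_rfl⟩

/-- The image of the Galois group is all of `M a` if it lies in `M a` and no character of `M a`
vanishes on it. -/
theorem imRho_eq_of_levelChar [IsGalois F K] {a : ℕ →₀ ZMod 2} (hH : imRho ι ≤ M a)
    (hχ : ∀ n χ, LevelChar a n χ → (∀ σ ∈ imRho ι, χ σ = 0) → ∀ σ ∈ M a, χ σ = 0) :
    imRho ι = M a := by
  refine le_antisymm hH fun σ hσ => ι.mem_imRho_of_forall_agree fun n => ?_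
  obtain ⟨m, hm⟩ := exists_bound a
  obtain ⟨η, hη, e⟩ := exists_agree_of_levelChar (n := max m n)
    (fun i hi => (hm i hi).trans_le (le_max_left _ _)) hH (hχ _) hσ
  exact ⟨η, hη, fun w hw => e w (hw.trans (le_max_right _ _))⟩

end Labeling

/-! ## Existence of a labeling -/

/-- The labels are assigned upwards from the root by choosing a square root of `β + δ` at each
vertex. Separability ensures that the two children are distinct. -/
theorem exists_labeling [IsSepClosed K] (h2 : (2 : K) ≠ 0) (γ δ : F)
    (hsep : ∀ n : ℕ, (iter (quad γ δ) n).Separable) : Nonempty (Labeling (quad γ δ) K) := by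
  have : NeZero (2 : K) := ⟨h2⟩
  choose r hr using fun x : K => IsSepClosed.exists_eq_mul_self x
  let γ' := algebraMap F K γ
  let δ' := algebraMap F K δ
  let rt : Word → K := fun w =>
    List.rec 0 (fun s _ x => γ' + if s then -r (x + δ') else r (x + δ')) w
  have hrt : ∀ s w, rt (s :: w) = γ' + if s then -r (rt w + δ') else r (rt w + δ') :=
    fun _ _ => rfl
  have hf : ∀ s w, aeval (rt (s :: w)) (quad γ δ) = rt w := by
    intro s w
    rw [quad_aeval, hrt]
    have := hr (rt w + δ')
    cases s <;> simp only [Bool.false_eq_true, if_true, if_false] <;> linear_combination -this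
  have hroot : ∀ w : Word, aeval (rt w) (iter (quad γ δ) w.length) = 0 := by
    intro w
    induction w with
    | nil => simp [iter, rt]
    | cons s w ih => rw [List.length_cons, iter_succ', aeval_comp, hf, ih]
  -- If the two children coincide, then `rt w = -δ = f(γ)`, so `γ` is a root of the next iterate.
  -- Its derivative also vanishes there because `f'(γ) = 0`.
  have hne : ∀ w, r (rt w + δ') ≠ 0 := by
    intro w h0
    have hz : rt w = algebraMap F K (-δ) := by
      have := hr (rt w + δ')
      rw [h0, mul_zero] at this
      rw [map_neg]
      exact eq_neg_of_add_eq_zero_left this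
    have h := hroot w
    rw [hz, aeval_algebraMap_apply_eq_algebraMap_eval] at h
    have hev : (iter (quad γ δ) w.length).eval (-δ) = 0 :=
      (algebraMap F K).injective (h.trans (map_zero _).symm)
    have hq : (quad γ δ).eval γ = -δ := by rw [quad_eval]; ring
    refine (hsep (w.length + 1)).aeval_derivative_ne_zero (x := γ) ?_ ?_
    · rw [coe_aeval_eq_eval, iter_succ_eval, hq, hev]
    · rw [iter_succ', derivative_comp, coe_aeval_eq_eval, eval_mul]
      have : (derivative (quad γ δ)).eval γ = 0 := by simp [quad, derivative_pow]
      rw [this, zero_mul]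
  have hinj : ∀ v w : Word, v.length = w.length → rt v = rt w → v = w := by
    intro v
    induction v with
    | nil => intro w hl _; exact (List.length_eq_zero_iff.1 hl.symm).symm
    | cons s v ih =>
      intro w hl h
      cases w with
      | nil => simp at hl
      | cons t w =>
        obtain rfl : v = w := ih w (by simpa using hl) (by rw [← hf s, ← hf t, h])
        rw [hrt, hrt] at h
        have h' := add_left_cancel h
        have hx : r (rt v + δ') ≠ - r (rt v + δ') := by
          intro e
          have : 2 * r (rt v + δ') = 0 := by linear_combination e
          rcases mul_eq_zero.1 this with h | h
          · exact h2 h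
          · exact hne v h
        cases s <;> cases t
        · rfl
        · exact absurd h' hx
        · exact absurd h'.symm hx
        · rfl
  let node : Word → Node (quad γ δ) K := fun w => ⟨w.length, rt w, hroot w⟩
  have hsurj : ∀ (n : ℕ) (p : Node (quad γ δ) K), p.level = n → ∃ w, node w = p := by
    intro n
    induction n with
    | zero =>
      intro p hp
      refine ⟨[], Node.ext hp.symm ?_⟩
      have := p.aeval_val
      rw [hp] at this
      have h0 : p.val = 0 := by simpa [iter] using this
      rw [h0]
      rfl
    | succ n ih =>
      intro p hp
      obtain ⟨q, hq⟩ := p.exists_parent hp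
      obtain ⟨w, rfl⟩ := ih q (by have := hq.1; omega)
      have hval : aeval p.val (quad γ δ) = rt w := hq.2
      rw [quad_aeval] at hval
      have : (p.val - γ') ^ 2 = r (rt w + δ') ^ 2 := by
        have := hr (rt w + δ')
        linear_combination hval + this
      rw [sq_eq_sq_iff_eq_or_eq_neg] at this
      rcases this with e | e
      · refine ⟨false :: w, Node.ext hq.1.symm ?_⟩
        change rt (false :: w) = _
        rw [hrt]
        simp only [Bool.false_eq_true, if_false]
        linear_combination -e
      · refine ⟨true :: w, Node.ext hq.1.symm ?_⟩
        change rt (true :: w) = _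
        rw [hrt]
        simp only [if_true]
        linear_combination -e
  have hbij : Function.Bijective node :=
    ⟨fun v w h => hinj v w (congrArg Node.level h) (congrArg Node.val h),
      fun p => hsurj _ p rfl⟩
  refine ⟨RelIso.symm ⟨Equiv.ofBijective node hbij, fun {w v} => ⟨?_, ?_⟩⟩⟩
  · rintro ⟨hl, hv⟩
    change v.length = w.length + 1 at hl
    change aeval (rt v) (quad γ δ) = rt w at hv
    cases v with
    | nil => simp at hl
    | cons s v =>
      rw [hf] at hv
      rw [hinj v w (by simpa using hl) hv]
      exact ⟨s, rfl⟩
  · rintro ⟨s, rfl⟩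
    exact ⟨rfl, hf s w⟩

end

/-! ## Square classes -/

section SqClass

variable {F : Type u} [Field F]

theorem sqClass_mul (z w : Fˣ) : sqClass (z * w) = sqClass z + sqClass w := rfl

theorem sqClass_eq_zero {z : Fˣ} : sqClass z = 0 ↔ IsUnitSq (z : F) := by
  refine (QuotientGroup.eq_one_iff z).trans ?_
  constructor
  · rintro ⟨w, rfl⟩
    exact ⟨w, rfl⟩
  · rintro ⟨w, hw⟩
    exact ⟨w, Units.ext hw.symm⟩

theorem sqClass_add_self (x : SqClass F) : x + x = 0 :=
  (two_nsmul x).symm.trans (two_nsmul_sqClass x)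

theorem sqClass_neg (x : SqClass F) : -x = x :=
  congrArg Additive.ofMul (inv_eq_of_mul_eq_one_left (a := x.toMul) (b := x.toMul)
    (congrArg Additive.toMul (sqClass_add_self x)))

theorem sqClass_sub (z w : Fˣ) : sqClass z - sqClass w = sqClass (z * w) :=
  (congrArg Additive.ofMul (div_eq_mul_inv (sqClass z).toMul (sqClass w).toMul)).trans
    (congrArg (sqClass z + ·) (sqClass_neg (sqClass w)))

theorem sum_smul_sqClass {I : Type*} (z : I → Fˣ) (b : I →₀ ZMod 2) :
    (b.sum fun i e => e • sqClass (z i)) = sqClass (b.prod fun i e => z i ^ e.val) := by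
  classical
  have h : ∀ (e : ZMod 2) (w : Fˣ), e • sqClass w = sqClass (w ^ e.val) := by
    intro e w
    rcases zmod_two_cases e with rfl | rfl
    · rw [zero_smul, ZMod.val_zero, pow_zero]; rfl
    · rw [one_smul, ZMod.val_one, pow_one]
  simp only [h, Finsupp.sum, Finsupp.prod]
  induction b.support using Finset.induction_on with
  | empty => rfl
  | insert i s hi ih => rw [Finset.sum_insert hi, Finset.prod_insert hi, sqClass_mul, ih]

variable {K : Type v} [Field K] [Algebra F K] [IsGalois F K]

/-- A product of the `x i` is a square exactly when the matching combination of characters vanishes,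
so independence of classes is independence of characters on the Galois group. -/
theorem indepModSq_iff (h2 : (2 : K) ≠ 0) {I : Type} {x : I → F}
    {χ : I → (K ≃ₐ[F] K) → ZMod 2} (h : ∀ i, IsKummer (x i) (χ i)) :
    IndepModSq x ↔ ∀ b : I →₀ ZMod 2, (∀ g, (b.sum fun i e => e * χ i g) = 0) → b = 0 := by
  have key : ∀ z : I → Fˣ, (∀ i, (z i : F) = x i) → ∀ b : I →₀ ZMod 2,
      (b.sum fun i e => e • sqClass (z i)) = 0 ↔ ∀ g, (b.sum fun i e => e * χ i g) = 0 := by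
    intro z hz b
    rw [sum_smul_sqClass, sqClass_eq_zero, ← (IsKummer.prod b h).isUnitSq_iff h2]
    have : ((b.prod fun i e => z i ^ e.val : Fˣ) : F) = b.prod fun i e => x i ^ e.val := by
      simp [Finsupp.prod, hz]
    rw [this]
  constructor
  · rintro ⟨z, hz, hl⟩ b hb
    exact linearIndependent_iff.1 hl b ((key z hz b).2 hb)
  · intro hb
    have hz : ∀ i, ((Units.mk0 (x i) (h i).ne_zero : Fˣ) : F) = x i := fun _ => rfl
    exact ⟨_, hz, linearIndependent_iff.2 fun b hb' => hb b ((key _ hz b).1 hb')⟩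

end SqClass

/-! ## Testing with the generators -/

/-- Single flips in `M a` force `b` to vanish outside the support of `a`; pairs of flips force it to
be constant on that support. -/
theorem eq_of_M_le {a b : ℕ →₀ ZMod 2} (h : M a ≤ M b) (hb : b ≠ 0) : b = a := by
  obtain ⟨j, hj⟩ := Finsupp.ne_iff.1 hb
  have hj1 : b j = 1 := zmod_two_eq_one.1 hj
  have h0 : ∀ i, a i = 0 → b i = 0 := fun i hi => by
    have : flip (List.replicate i false) ∈ M b := h (flip_mem_M.2 (by simpa using hi))
    simpa [flip_mem_M] using this
  have haj : a j = 1 := zmod_two_eq_one.1 fun h => hj (h0 j h)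
  ext i
  rcases zmod_two_cases (a i) with hi | hi
  · rw [hi, h0 i hi]
  · have : flip (List.replicate i false) * flip (List.replicate j false) ∈ M b :=
      h (pair_mem_M (by simpa using hi) (by simpa using haj))
    rw [mem_M, phiSum_mul, phiSum_flip, phiSum_flip, CharTwo.add_eq_zero] at this
    simp only [List.length_replicate] at this
    rw [this, hj1, hi]

/-- The character `ψ` is not a combination of the characters `φ i` on `M a`. -/
theorem exists_psi_ne {a : ℕ →₀ ZMod 2} (ha : a ≠ 0) (ha0 : a 0 = 0) :
    ∃ σ ∈ M a, psi a true σ = 1 ∧ ∀ b, phiSum b σ = 0 := by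
  obtain ⟨k, hk⟩ := Finsupp.ne_iff.1 ha
  have hak : a k = 1 := zmod_two_eq_one.1 hk
  have hk0 : k ≠ 0 := by rintro rfl; exact hk ha0
  have hf : ¬ [true] <:+ List.replicate k false :=
    (suffix_singleton_iff false _ (by simpa using hk0)).1 (singleton_suffix_replicate hk0 false)
  have ht := singleton_suffix_replicate hk0 true
  have hfix : flip (List.replicate k true) [true] = [true] :=
    flip_apply_of_length_le _ (by simp; omega)
  -- The two flips have the same level, so each `φ_i` cancels; they lie in different halves, so
  -- `psi` sees only one.
  refine ⟨flip (List.replicate k false) * flip (List.replicate k true),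
    pair_mem_M (by simpa using hak) (by simpa using hak), ?_, fun b => ?_⟩
  · rw [psi_mul a _ hfix, psi_flip, psi_flip, if_neg hf, if_pos ht]
    simpa using hak
  · rw [phiSum_mul, phiSum_flip, phiSum_flip]
    simp only [List.length_replicate]
    exact CharTwo.add_self_eq_zero _

theorem map_singleton_of_phi_zero_ne {σ : Omega} (h : phi 0 σ ≠ 0) (s : Bool) :
    σ [s] = [!s] := by
  rw [phi_zero_eq, zmod_two_eq_one] at h
  rw [σ.map_cons_swap, h, σ.map_nil]
  simp

namespace Labeling

variable {F : Type u} [Field F] {K : Type v} [Field K] [Algebra F K]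
variable {γ δ : F} (ι : Labeling (quad γ δ) K)

theorem isUnitSq_orbitProd_iff [IsGalois F K] (h2 : (2 : K) ≠ 0) (b : ℕ →₀ ZMod 2) :
    IsUnitSq (orbitProd γ δ b) ↔ imRho ι ≤ M b := by
  rw [(ι.isKummer_orbitProd b).isUnitSq_iff h2]
  constructor
  · intro h σ hσ
    obtain ⟨g, rfl⟩ := ι.mem_imRho.1 hσ
    exact h g
  · intro h g
    exact h (ι.mem_imRho.2 ⟨g, rfl⟩)

theorem onlySquare_iff [IsGalois F K] (h2 : (2 : K) ≠ 0) (a : ℕ →₀ ZMod 2) :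
    OnlySquare γ δ a ↔ imRho ι ≤ M a ∧ ∀ b, imRho ι ≤ M b → b = 0 ∨ b = a := by
  simp only [OnlySquare, ι.isUnitSq_orbitProd_iff h2]
  refine and_congr_right fun _ => forall_congr' fun b => ?_
  tauto

theorem sqClass_mem_orbitSpan_iff [IsGalois F K] (h2 : (2 : K) ≠ 0) {z : Fˣ}
    {χ : (K ≃ₐ[F] K) → ZMod 2} (h : IsKummer (z : F) χ) :
    sqClass z ∈ orbitSpan γ δ ↔
      ∃ b : ℕ →₀ ZMod 2, ∀ g, χ g + phiSum b (ι.galAct g) = 0 := by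
  let c : ℕ → Fˣ := fun n => Units.mk0 (orbit γ δ n) (ι.isKummer_orbit n).ne_zero
  have hr : {y | ∃ (n : ℕ) (z : Fˣ), (z : F) = orbit γ δ n ∧ y = sqClass z} =
      Set.range fun n => sqClass (c n) := by
    ext y
    constructor
    · rintro ⟨n, z, hz, rfl⟩
      exact ⟨n, congrArg sqClass (Units.ext hz.symm)⟩
    · rintro ⟨n, rfl⟩
      exact ⟨n, c n, rfl, rfl⟩
  rw [orbitSpan, hr, Finsupp.mem_span_range_iff_exists_finsupp]
  refine exists_congr fun b => ?_
  rw [← (h.mul (ι.isKummer_orbitProd b)).isUnitSq_iff h2, sum_smul_sqClass]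
  have e : (z : F) * orbitProd γ δ b = ((z * b.prod fun i e => c i ^ e.val : Fˣ) : F) := by
    simp [orbitProd, Finsupp.prod, c]
  rw [e, ← sqClass_eq_zero, sqClass_mul]
  constructor
  · intro h; rw [h, sqClass_add_self]
  · intro h
    exact (eq_neg_of_add_eq_zero_right h).trans (sqClass_neg _)

/-! ## The auxiliary element -/

/-- The square root of `c̃_a(s)`. -/
noncomputable def auxRoot (a : ℕ →₀ ZMod 2) (s : Bool) : K :=
  a.prod fun i e => ι.radProd [s] i ^ e.val

variable {a : ℕ →₀ ZMod 2}

theorem auxRoot_ne_zero (s : Bool) : ι.auxRoot a s ≠ 0 :=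
  Finset.prod_ne_zero_iff.2 fun _ _ => pow_ne_zero _ (ι.radProd_ne_zero _ _)

theorem auxRoot_sq (ha0 : a 0 = 0) (s : Bool) : ι.auxRoot a s ^ 2 = cTildeProd ι a s := by
  unfold auxRoot cTildeProd Finsupp.prod
  rw [← Finset.prod_pow]
  refine Finset.prod_congr rfl fun i hi => ?_
  have hi0 : i ≠ 0 := by rintro rfl; exact Finsupp.mem_support_iff.1 hi ha0
  obtain ⟨j, rfl⟩ := Nat.exists_eq_succ_of_ne_zero hi0
  simp only [Nat.succ_eq_add_one]
  rw [← ι.radProd_singleton_sq, ← pow_mul, ← pow_mul, mul_comm]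

theorem map_auxRoot (g : K ≃ₐ[F] K) {s t : Bool} (h : ι.galAct g [s] = [t]) :
    g (ι.auxRoot a s) = sgn K (psi a s (ι.galAct g)) * ι.auxRoot a t := by
  simp only [auxRoot, psi, Finsupp.prod, Finsupp.sum, map_prod, map_pow, map_radProd, h, sgn_sum,
    sgn_mul, mul_pow, Finset.prod_mul_distrib]

/-- On `M a` both halves carry the same sign `psi`. An automorphism exchanging the halves also swaps
the two roots, which costs a further factor `sgn e`; hence the term `e * φ_0`. -/
theorem map_auxRoot_add (ha0 : a 0 = 0) (hM : imRho ι ≤ M a) (e : ZMod 2) (g : K ≃ₐ[F] K) :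
    g (ι.auxRoot a false + sgn K e * ι.auxRoot a true) =
      sgn K (psi a true (ι.galAct g) + e * phi 0 (ι.galAct g)) *
        (ι.auxRoot a false + sgn K e * ι.auxRoot a true) := by
  have hψ := psi_eq_psi ha0 (hM (ι.mem_imRho.2 ⟨g, rfl⟩)) false true
  rw [map_add, map_mul, map_sgn, sgn_add]
  by_cases h : phi 0 (ι.galAct g) = 0
  · have hs := phi_zero_of_map_singleton.1 h
    rw [ι.map_auxRoot g (hs false), ι.map_auxRoot g (hs true), hψ, h, mul_zero, sgn_zero]
    ring
  · have hs := map_singleton_of_phi_zero_ne h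
    rw [ι.map_auxRoot g (hs false), ι.map_auxRoot g (hs true), hψ, zmod_two_eq_one.1 h, mul_one]
    have := sgn_sq (K := K) e
    simp only [Bool.not_false, Bool.not_true]
    linear_combination (- sgn K (psi a true (ι.galAct g)) * ι.auxRoot a true) * this

/-- The choice of `d` is the choice of sign in `r_x ± r_y`, whose square is the auxiliary element.
-/
theorem isKummer_of_isAuxElement (ha0 : a 0 = 0) (hM : imRho ι ≤ M a) {z : Fˣ}
    (h : IsAuxElement ι a z) : ∃ e : ZMod 2,
      IsKummer (z : F) fun g => psi a true (ι.galAct g) + e * phi 0 (ι.galAct g) := by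
  obtain ⟨d, hd, hz⟩ := h
  rw [← ι.auxRoot_sq ha0, ← ι.auxRoot_sq ha0] at hd hz
  rw [← mul_pow, sq_eq_sq_iff_eq_or_eq_neg] at hd
  obtain ⟨e, he⟩ : ∃ e : ZMod 2,
      algebraMap F K d = sgn K e * (ι.auxRoot a false * ι.auxRoot a true) := by
    rcases hd with hd | hd
    · exact ⟨0, by rw [hd, sgn_zero, one_mul]⟩
    · exact ⟨1, by rw [hd, sgn_one]; ring⟩
  have hsq : (ι.auxRoot a false + sgn K e * ι.auxRoot a true) ^ 2 = algebraMap F K z := by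
    rw [hz, he]
    linear_combination (ι.auxRoot a true) ^ 2 * sgn_sq (K := K) e
  refine ⟨e, _, ?_, hsq, ι.map_auxRoot_add ha0 hM e⟩
  rintro h0
  rw [h0, zero_pow two_ne_zero] at hsq
  exact z.ne_zero ((algebraMap F K).injective (hsq.symm.trans (map_zero _).symm))

/-- The sum and the difference of the nonzero roots `r_x`, `r_y` cannot both vanish when `2 ≠ 0`.
Their product is fixed by Galois because the two signs agree, which puts `d` in `F`. -/
theorem exists_isAuxElement [IsGalois F K] (h2 : (2 : K) ≠ 0) (ha0 : a 0 = 0)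
    (hM : imRho ι ≤ M a) : ∃ z : Fˣ, IsAuxElement ι a z := by
  obtain ⟨e, he⟩ : ∃ e : ZMod 2, ι.auxRoot a false + sgn K e * ι.auxRoot a true ≠ 0 := by
    by_contra! hn
    have h0 := hn 0
    have h1 := hn 1
    rw [sgn_zero] at h0
    rw [sgn_one] at h1
    have : 2 * ι.auxRoot a false = 0 := by linear_combination h0 + h1
    rcases mul_eq_zero.1 this with h | h
    · exact h2 h
    · exact ι.auxRoot_ne_zero false h
  obtain ⟨d, hd⟩ := (InfiniteGalois.mem_range_algebraMap_iff_fixed (k := F)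
    (sgn K e * (ι.auxRoot a false * ι.auxRoot a true))).2 fun g => by
      have hψ := psi_eq_psi ha0 (hM (ι.mem_imRho.2 ⟨g, rfl⟩)) false true
      have h1 := sgn_sq (K := K) (psi a true (ι.galAct g))
      rw [map_mul, map_mul, map_sgn]
      by_cases h : phi 0 (ι.galAct g) = 0
      · have hs := phi_zero_of_map_singleton.1 h
        rw [ι.map_auxRoot g (hs false), ι.map_auxRoot g (hs true), hψ]
        linear_combination (sgn K e * ι.auxRoot a false * ι.auxRoot a true) * h1
      · have hs := map_singleton_of_phi_zero_ne h
        rw [ι.map_auxRoot g (hs false), ι.map_auxRoot g (hs true), hψ]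
        simp only [Bool.not_false, Bool.not_true]
        linear_combination (sgn K e * ι.auxRoot a false * ι.auxRoot a true) * h1
  obtain ⟨z, hz⟩ := (InfiniteGalois.mem_range_algebraMap_iff_fixed (k := F)
    ((ι.auxRoot a false + sgn K e * ι.auxRoot a true) ^ 2)).2 fun g => by
      rw [map_pow, ι.map_auxRoot_add ha0 hM, mul_pow, sgn_sq, one_mul]
  have hz0 : z ≠ 0 := by
    rintro rfl
    rw [map_zero] at hz
    exact pow_ne_zero 2 he hz.symm
  refine ⟨Units.mk0 z hz0, d, ?_, ?_⟩
  · rw [hd, ← ι.auxRoot_sq ha0, ← ι.auxRoot_sq ha0, mul_pow, sgn_sq, one_mul, mul_pow]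
  · rw [Units.val_mk0, hz, hd, ← ι.auxRoot_sq ha0, ← ι.auxRoot_sq ha0]
    linear_combination (ι.auxRoot a true) ^ 2 * sgn_sq (K := K) e

/-- The characters of two auxiliary elements differ by a multiple of `φ_0`, that is, by a power of
`c_0`. -/
theorem sqClass_sub_mem_orbitSpan [IsGalois F K] (h2 : (2 : K) ≠ 0) (ha0 : a 0 = 0)
    (hM : imRho ι ≤ M a) {z z' : Fˣ} (hz : IsAuxElement ι a z) (hz' : IsAuxElement ι a z') :
    sqClass z - sqClass z' ∈ orbitSpan γ δ := by
  obtain ⟨e, he⟩ := ι.isKummer_of_isAuxElement ha0 hM hz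
  obtain ⟨e', he'⟩ := ι.isKummer_of_isAuxElement ha0 hM hz'
  rw [sqClass_sub]
  have hk : IsKummer ((z * z' : Fˣ) : F) _ := he.mul he'
  rw [ι.sqClass_mem_orbitSpan_iff h2 hk]
  refine ⟨Finsupp.single 0 (e + e'), fun g => ?_⟩
  have : phiSum (Finsupp.single 0 (e + e')) (ι.galAct g) = (e + e') * phi 0 (ι.galAct g) :=
    Finsupp.sum_single_index (zero_mul _)
  rw [this]
  have h0 : (2 : ZMod 2) = 0 := by decide
  linear_combination (psi a true (ι.galAct g) + (e + e') * phi 0 (ι.galAct g)) * h0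

/-! ## The criteria -/

theorem imRho_eq_iff_of_ne_single [IsGalois F K] (h2 : (2 : K) ≠ 0) (ha : a ≠ 0)
    (ha' : a ≠ Finsupp.single 0 1) :
    imRho ι = M a ↔ (a 0 = 1 ∧ OnlySquare γ δ a) ∨
      (a 0 = 0 ∧ OnlySquare γ δ a ∧
        ∃ z : Fˣ, IsAuxElement ι a z ∧ sqClass z ∉ orbitSpan γ δ) := by
  rw [ι.onlySquare_iff h2]
  constructor
  · intro h
    have honly : imRho ι ≤ M a ∧ ∀ b, imRho ι ≤ M b → b = 0 ∨ b = a := by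
      refine ⟨h.le, fun b hb => ?_⟩
      rw [h] at hb
      exact or_iff_not_imp_left.2 (eq_of_M_le hb)
    rcases zmod_two_cases (a 0) with ha0 | ha0
    · right
      obtain ⟨z, hz⟩ := ι.exists_isAuxElement h2 ha0 h.le
      refine ⟨ha0, honly, z, hz, ?_⟩
      obtain ⟨e, he⟩ := ι.isKummer_of_isAuxElement ha0 h.le hz
      rw [ι.sqClass_mem_orbitSpan_iff h2 he]
      rintro ⟨b, hb⟩
      -- An element of the full group `M a` seen by `psi` but by no `φ_i` rules out any relation
      -- with the orbit.
      obtain ⟨σ, hσ, h1, h0⟩ := exists_psi_ne ha ha0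
      rw [← h] at hσ
      obtain ⟨g, rfl⟩ := ι.mem_imRho.1 hσ
      have := hb g
      rw [h1, h0, ← phiSum_single, h0, mul_zero, add_zero, add_zero] at this
      exact one_ne_zero this
    · exact Or.inl ⟨ha0, honly⟩
  · rintro (⟨ha0, hM, hb⟩ | ⟨ha0, ⟨hM, hb⟩, z, hz, hns⟩)
    · refine ι.imRho_eq_of_levelChar hM fun n χ hχ hv => ?_
      obtain ⟨b, hχb⟩ := hχ.exists_eq_of_one ha' ha0
      have hle : imRho ι ≤ M b := fun σ hσ => by rw [mem_M, ← hχb σ (hM hσ), hv σ hσ]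
      intro σ hσ
      rw [hχb σ hσ]
      rcases hb b hle with rfl | rfl
      · simp [phiSum]
      · exact hσ
    · refine ι.imRho_eq_of_levelChar hM fun n χ hχ hv => ?_
      obtain ⟨b, e, hχb⟩ := hχ.exists_eq_of_zero ha ha0
      rcases zmod_two_cases e with rfl | rfl
      · simp only [zero_mul, add_zero] at hχb
        have hle : imRho ι ≤ M b := fun σ hσ => by rw [mem_M, ← hχb σ (hM hσ), hv σ hσ]
        intro σ hσ
        rw [hχb σ hσ]
        rcases hb b hle with rfl | rfl
        · simp [phiSum]
        · exact hσ
      · exfalso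
        obtain ⟨d, hd⟩ := ι.isKummer_of_isAuxElement ha0 hM hz
        -- A character involving `psi` that vanishes on the image would equate `psi` with a
        -- combination of the `φ_i` there. After adding `d * φ_0`, this places the auxiliary element
        -- in the span.
        refine hns ((ι.sqClass_mem_orbitSpan_iff h2 hd).2 ⟨b + Finsupp.single 0 d, fun g => ?_⟩)
        have hg := ι.mem_imRho.2 ⟨g, rfl⟩
        have h0 := hχb _ (hM hg)
        rw [hv _ hg, one_mul] at h0
        have hadd : phiSum (b + Finsupp.single 0 d) (ι.galAct g) =
            phiSum b (ι.galAct g) + d * phi 0 (ι.galAct g) := by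
          unfold phiSum
          rw [Finsupp.sum_add_index' (by simp) (by intros; ring)]
          simp
        rw [hadd, add_add_add_comm, CharTwo.add_self_eq_zero, add_zero, add_comm, ← h0]

theorem root_singleton_eq {u : F} (hu : u ^ 2 = δ) :
    ∃ t : Bool, ∀ s : Bool, ι.root [xor s t] = algebraMap F K (γ + if s then u else -u) := by
  have h := ι.rad_sq []
  have hu' : algebraMap F K δ = algebraMap F K u ^ 2 := by rw [← map_pow, hu]
  rw [root_nil, zero_add, hu', sq_eq_sq_iff_eq_or_eq_neg] at h
  rcases h with h | h
  · refine ⟨true, fun s => ?_⟩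
    cases s <;> simp [root_false, root_true, h, sub_eq_add_neg]
  · refine ⟨false, fun s => ?_⟩
    cases s <;> simp [root_false, root_true, h]

theorem isKummer_cTilde (hM : imRho ι ≤ M (Finsupp.single 0 1)) {z : F} {s : Bool} {n : ℕ}
    (hz : algebraMap F K z = cTilde ι s (n + 1)) :
    IsKummer z fun g => phiAt [s] (n + 1) (ι.galAct g) := by
  refine ⟨ι.radProd [s] (n + 1), ι.radProd_ne_zero _ _, by rw [radProd_singleton_sq, hz],
    fun g => ?_⟩
  have h : phi 0 (ι.galAct g) = 0 := by
    rw [← phiSum_single]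
    exact hM (ι.mem_imRho.2 ⟨g, rfl⟩)
  rw [map_radProd, phi_zero_of_map_singleton.1 h]

theorem exists_isKummer_signFamily (hM : imRho ι ≤ M (Finsupp.single 0 1)) {u : F}
    (hu : u ^ 2 = δ) : ∃ T : ℕ × Bool ≃ ℕ × Bool, ∀ p,
      IsKummer (signFamily γ δ u p) fun g => phiAt [(T p).2] ((T p).1 + 1) (ι.galAct g) := by
  obtain ⟨t, ht⟩ := ι.root_singleton_eq hu
  -- The labeling may match the sign of `u` with either letter, recorded by `t`. The matching is
  -- reversed for `n ≥ 1`, since the root enters `c_0 + α_s` with a plus sign but `c_n - α_s` with a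
  -- minus sign.
  let c : ℕ → Bool := fun n => if n = 0 then t else !t
  have hc : Function.Involutive fun p : ℕ × Bool => (p.1, xor p.2 (c p.1)) := fun p => by simp
  refine ⟨hc.toPerm _, ?_⟩
  rintro ⟨n, s⟩
  refine ι.isKummer_cTilde hM ?_
  cases n with
  | zero =>
    change _ = algebraMap F K (orbit γ δ 0) + ι.root [xor s t]
    rw [ht, ← map_add, signFamily, add_assoc]
  | succ n =>
    change _ = algebraMap F K (orbit γ δ (n + 1)) - ι.root [xor s (!t)]
    have : xor s (!t) = xor (!s) t := by cases s <;> cases t <;> rfl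
    rw [this, ht, ← map_sub, signFamily]
    congr 1
    cases s <;> simp <;> ring

/-- The flips at the words `s^(j+1)` are dual to the characters of the two halves, so they read off
single coefficients. -/
theorem sum_phiAt_flip (b : ℕ × Bool →₀ ZMod 2) (T : ℕ × Bool ≃ ℕ × Bool) (p : ℕ × Bool) :
    (b.sum fun q e => e * phiAt [(T q).2] ((T q).1 + 1)
      (flip (List.replicate ((T p).1 + 1) (T p).2))) = b p := by
  have h : ∀ q, phiAt [(T q).2] ((T q).1 + 1) (flip (List.replicate ((T p).1 + 1) (T p).2)) =
      if q = p then 1 else 0 := by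
    intro q
    rw [phiAt_flip]
    refine if_congr ?_ rfl rfl
    rw [← T.injective.eq_iff (a := q), Prod.ext_iff, List.length_replicate]
    have hs := singleton_suffix_replicate ((T p).1.succ_ne_zero) (T p).2
    constructor
    · rintro ⟨h1, h2⟩
      refine ⟨by omega, ?_⟩
      by_contra hne
      have : (T q).2 = !(T p).2 := by
        cases h3 : (T q).2 <;> cases h4 : (T p).2 <;> simp_all
      rw [this] at h2
      exact (suffix_singleton_iff (T p).2 _ (by simp)).1 hs h2
    · rintro ⟨h1, h2⟩
      exact ⟨by omega, by rw [h2]; exact hs⟩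
  simp only [h, mul_ite, mul_one, mul_zero]
  rw [Finsupp.sum_ite_eq']
  split
  · rfl
  · exact (Finsupp.notMem_support_iff.1 ‹_›).symm

theorem imRho_le_M_single_iff [IsGalois F K] (h2 : (2 : K) ≠ 0) :
    imRho ι ≤ M (Finsupp.single 0 1) ↔ ∃ u : F, u ^ 2 = δ := by
  have hδ : orbitProd γ δ (Finsupp.single 0 1) = δ := by
    rw [orbitProd, Finsupp.prod_single_index (by simp), ZMod.val_one, pow_one, orbit_zero]
  rw [← ι.isUnitSq_orbitProd_iff h2, hδ]
  constructor
  · rintro ⟨w, hw⟩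
    exact ⟨w, hw.symm⟩
  · rintro ⟨u, hu⟩
    have h0 := (ι.isKummer_orbit 0).ne_zero
    rw [orbit_zero, ← hu] at h0
    exact ⟨Units.mk0 u (by rintro rfl; simp at h0), hu.symm⟩

theorem imRho_eq_iff_of_single [IsGalois F K] (h2 : (2 : K) ≠ 0) :
    imRho ι = M (Finsupp.single 0 1) ↔
      ∃ u : F, u ^ 2 = δ ∧ IndepModSq (signFamily γ δ u) := by
  constructor
  · intro h
    obtain ⟨u, hu⟩ := (ι.imRho_le_M_single_iff h2).1 h.le
    refine ⟨u, hu, ?_⟩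
    obtain ⟨T, hT⟩ := ι.exists_isKummer_signFamily h.le hu
    rw [indepModSq_iff h2 hT]
    intro b hb
    ext p
    have hmem : flip (List.replicate ((T p).1 + 1) (T p).2) ∈ imRho ι := by
      rw [h, flip_mem_M, Finsupp.single_eq_of_ne (by simp)]
    obtain ⟨g, hg⟩ := ι.mem_imRho.1 hmem
    rw [← sum_phiAt_flip b T p, ← hg, hb g]
    rfl
  · rintro ⟨u, hu, hind⟩
    have hM := (ι.imRho_le_M_single_iff h2).2 ⟨u, hu⟩
    refine ι.imRho_eq_of_levelChar hM fun n χ hχ hv => ?_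
    obtain ⟨T, hT⟩ := ι.exists_isKummer_signFamily hM hu
    rw [indepModSq_iff h2 hT] at hind
    obtain ⟨b, hb⟩ := hχ.exists_eq_of_single
    -- The coefficients are transported to the indexing of the sign family, where independence
    -- applies.
    have hz : b.equivMapDomain T.symm = 0 := by
      refine hind _ fun g => ?_
      have hg := ι.mem_imRho.2 ⟨g, rfl⟩
      rw [Finsupp.sum_equivMapDomain]
      simp only [Equiv.apply_symm_apply]
      rw [← hb _ (hM hg), hv _ hg]
    have hb0 : b = 0 := by
      ext p
      have := DFunLike.congr_fun hz (T.symm p)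
      rw [Finsupp.equivMapDomain_apply] at this
      simpa using this
    intro σ hσ
    rw [hb σ hσ, hb0, Finsupp.sum_zero_index]

/-! ## Stability -/

theorem isStableFor_quad [IsGalois F K] (ha : a ≠ 0) (ha' : a ≠ Finsupp.single 0 1)
    (h : imRho ι = M a) : IsStableFor (quad γ δ) (quad γ δ) := by
  intro n _
  rw [← iter_succ]
  refine ι.irreducible_of_transitive (n + 1) [] (iter_monic γ δ _) (iter_natDegree γ δ _) ?_ ?_
  · intro u hu
    rw [← hu, aeval_root_append, root_nil]
  · intro u u' hu hu'
    rw [h]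
    exact exists_mem_M_map_eq ha ha' (by simp [hu, hu'])

theorem isStableFor_linear [IsGalois F K] (h : imRho ι = M (Finsupp.single 0 1)) {s : Bool} {c : F}
    (hc : ι.root [s] = algebraMap F K c) : IsStableFor (quad γ δ) (X - C c) := by
  intro n _
  have hd : (iter (quad γ δ) n).natDegree ≠ 0 := by
    rw [iter_natDegree]; positivity
  refine ι.irreducible_of_transitive n [s] ((monic_X_sub_C c).comp (iter_monic γ δ n) hd) ?_ ?_ ?_
  · rw [natDegree_comp, natDegree_X_sub_C, one_mul, iter_natDegree]
  · intro u hu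
    rw [aeval_comp, ← hu, aeval_root_append, hc]
    simp
  · intro u u' hu hu'
    -- The roots of the composed polynomial are the vertices above `[s]`, and masks over `[s]`, all
    -- in the group, permute each of their levels transitively.
    obtain ⟨m, hm⟩ := exists_mask [s] (w := u ++ [s]) (w' := u' ++ [s]) (by simp [hu, hu'])
      (List.suffix_append _ _) (List.suffix_append _ _)
    exact ⟨_, h ▸ mask_singleton_mem_M s m, hm⟩

theorem exists_linear_factors [IsGalois F K] (h2 : (2 : K) ≠ 0)
    (h : imRho ι = M (Finsupp.single 0 1)) :
    ∃ p q : F[X], p.natDegree = 1 ∧ q.natDegree = 1 ∧ quad γ δ = p * q ∧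
      IsStableFor (quad γ δ) p ∧ IsStableFor (quad γ δ) q := by
  obtain ⟨u, hu⟩ := (ι.imRho_le_M_single_iff h2).1 h.le
  obtain ⟨t, ht⟩ := ι.root_singleton_eq hu
  refine ⟨X - C _, X - C _, natDegree_X_sub_C _, natDegree_X_sub_C _, ?_,
    ι.isStableFor_linear h (ht true), ι.isStableFor_linear h (ht false)⟩
  simp only [quad, if_true, Bool.false_eq_true, if_false, map_add, map_neg, ← hu, map_pow]
  ring

end Labeling

end Arboreal

theorem theoremA {F : Type*} [Field F] (hF : ringChar F ≠ 2)
    (Fsep : Type*) [Field Fsep] [Algebra F Fsep] [IsSepClosure F Fsep]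
    (γ δ : F) (hsep : ∀ n : ℕ, (Arboreal.iter (Arboreal.quad γ δ) n).Separable) :
    -- the tree of `f` is isomorphic to the standard binary tree
    Nonempty (Arboreal.Labeling (Arboreal.quad γ δ) Fsep) ∧
    ∀ (ι : Arboreal.Labeling (Arboreal.quad γ δ) Fsep) (a : ℕ →₀ ZMod 2), a ≠ 0 →
      -- the auxiliary element exists, and is well defined modulo the span of the orbit
      (a 0 = 0 → Arboreal.IsUnitSq (Arboreal.orbitProd γ δ a) →
        (∃ z : Fˣ, Arboreal.IsAuxElement ι a z) ∧
        ∀ z z' : Fˣ, Arboreal.IsAuxElement ι a z → Arboreal.IsAuxElement ι a z' →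
          Arboreal.sqClass z - Arboreal.sqClass z' ∈ Arboreal.orbitSpan γ δ) ∧
      -- the case of a vector different from `e_0`
      (a ≠ Finsupp.single 0 1 →
        (Arboreal.imRho ι = Arboreal.M a ↔
          (a 0 = 1 ∧ Arboreal.OnlySquare γ δ a) ∨
          (a 0 = 0 ∧ Arboreal.OnlySquare γ δ a ∧
            ∃ z : Fˣ, Arboreal.IsAuxElement ι a z ∧
              Arboreal.sqClass z ∉ Arboreal.orbitSpan γ δ)) ∧
        (Arboreal.imRho ι = Arboreal.M a →
          Arboreal.IsStableFor (Arboreal.quad γ δ) (Arboreal.quad γ δ))) ∧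
      -- the case of the vector `e_0`
      (a = Finsupp.single 0 1 →
        (Arboreal.imRho ι = Arboreal.M a ↔
          ∃ u : F, u ^ 2 = δ ∧ Arboreal.IndepModSq (Arboreal.signFamily γ δ u)) ∧
        (Arboreal.imRho ι = Arboreal.M a →
          ∃ g h : Polynomial F, g.natDegree = 1 ∧ h.natDegree = 1 ∧
            Arboreal.quad γ δ = g * h ∧
            Arboreal.IsStableFor (Arboreal.quad γ δ) g ∧
            Arboreal.IsStableFor (Arboreal.quad γ δ) h)) := by
  have h2F : (2 : F) ≠ 0 := Ring.two_ne_zero hF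
  have h2 : (2 : Fsep) ≠ 0 := by
    rw [← map_ofNat (algebraMap F Fsep) 2]
    exact (_root_.map_ne_zero _).2 h2F
  have : IsSepClosed Fsep := IsSepClosure.sep_closed F
  have : IsGalois F Fsep := IsSepClosure.isGalois
  refine ⟨Arboreal.exists_labeling h2 γ δ hsep,
    fun ι a ha => ⟨fun ha0 hsq => ?_, fun ha' => ?_, ?_⟩⟩
  · have hM := (ι.isUnitSq_orbitProd_iff h2 a).1 hsq
    exact ⟨ι.exists_isAuxElement h2 ha0 hM, fun z z' => ι.sqClass_sub_mem_orbitSpan h2 ha0 hM⟩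
  · exact ⟨ι.imRho_eq_iff_of_ne_single h2 ha ha', ι.isStableFor_quad ha ha'⟩
  · rintro rfl
    exact ⟨ι.imRho_eq_iff_of_single h2, ι.exists_linear_factors h2⟩
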